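/- For every $n\in\mathbb N$ and $p\in[2,\infty)$ there exist constants $\alpha_0=\alpha_0(n,p)>0$, $c=c(n,p)>0$ and a positive function $\varepsilon\mapsto\delta(n,p,\varepsilon)$ with $\delta(n,p,\varepsilon)\to 0$ as $\varepsilon\searrow 0$, such that the following holds. Let $\Omega$ be a smooth $n$-dimensional manifold (Hausdorff, second countable, without boundary), let $T>0$, and let $(\Omega,\ell(t))_{t\in(0,T]}$ be a smooth (not necessarily complete) solution to Ricci flow, $\partial_t\ell=-2\,\mathrm{Rc}(\ell)$, such that for all $t\in(0,T]$ $$\int_\Omega|\mathrm{Rc}(\ell(t))|_{\ell(t)}\,d\ell(t)\le\varepsilon,\qquad |\mathrm{Rc}(\ell(t))|_{\ell(t)}\le\frac{\varepsilon}{t}\ \text{ on }\Omega,$$ where $0\le\varepsilon\le\alpha_0$. Here $d\ell(t)$ is the Riemannian volume measure of $\ell(t)$, $\mathrm{Vol}$ is the volume with respect to it, and $|\cdot|_{\ell(t)}$ is the norm on tensors induced by $\ell(t)$. (i) For all $s<t$ in $(0,T]$, $$\int_\Omega|\ell(t)-\ell(s)|^p_{\ell(t)}\,d\ell(t)\le\delta(n,p,\varepsilon)|t-s|,\qquad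 \int_\Omega|\ell(t)^{-1}-\ell(s)^{-1}|^p_{\ell(t)}\,d\ell(t)\le\delta(n,p,\varepsilon)|t-s|,$$ $$\int_\Omega|\ell(s)|^p_{\ell(t)}\,d\ell(t)\le c\,(\mathrm{Vol}(\Omega,\ell(t))+|t-s|),\qquad \int_\Omega|\ell(s)^{-1}|^p_{\ell(t)}\,d\ell(t)\le c\,(\mathrm{Vol}(\Omega,\ell(t))+|t-s|).$$ (ii) For all $r,s,t\in(0,T]$ with $r,s<t$, $$\int_\Omega|\ell(r)-\ell(s)|^p_{\ell(t)}\,d\ell(t)\le c\,(\mathrm{Vol}(\Omega,\ell(t))+t)^{3/4}|r-s|^{1/4},$$ $$\int_\Omega|\ell(r)^{-1}-\ell(s)^{-1}|^p_{\ell(t)}\,d\ell(t)\le c\,(\mathrm{Vol}(\Omega,\ell(t))+t)^{3/4}|r-s|^{1/4}.$$ (If $\mathrm{Vol}(\Omega,\ell(t))=\infty$, the right-hand sides are $\infty$, except that in (ii) they are $0$ for $r=s$.) (iii) There is a measurable symmetric two-tensor $\ell_0$ on $\Omega$, positive definite at every point, such that for every $t\in(0,T]$ $$\int_\Omega|\ell(s)-\ell_0|^p_{\ell(t)}\,d\ell(t)\to0\quad\text{and}\quad\int_\Omega|\ell(s)^{-1}-\ell_0^{-1}|^p_{\ell(t)}\,d\ell(t)\to0\quad\text{as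 } s\searrow0,$$ and $\int_A|\ell_0|^p_{\ell(t)}\,d\ell(t)<\infty$ and $\int_A|\ell_0^{-1}|^p_{\ell(t)}\,d\ell(t)<\infty$ for every Borel set $A\subseteq\Omega$ with $\mathrm{Vol}(A,\ell(t))<\infty$; in particular $\ell_0,\ell_0^{-1}\in L^p(\Omega,\ell(t))$ if $\mathrm{Vol}(\Omega,\ell(t))<\infty$, and $\ell_0,\ell_0^{-1}\in L^p_{\mathrm{loc}}$ in general. The tensor $\ell_0$ is unique: if $\ell_1$ is a measurable two-tensor and $\int_\Omega|\ell(s)-\ell_1|^p_{\ell(t)}\,d\ell(t)\to0$ as $s\searrow0$ for some $t\in(0,T]$, then $\ell_1=\ell_0$ almost everywhere. -/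

import Mathlib

open Set Filter Topology MeasureTheory
open scoped Manifold ContDiff ENNReal

noncomputable section

namespace RFlow

/-! ### Two-tensors and their components -/

/-- A (not necessarily continuous) field of bilinear forms, that is, a covariant two-tensor field,
on an `n`-dimensional manifold. -/
abbrev TwoTensor (n : ℕ) (Ω : Type*) [TopologicalSpace Ω]
    [ChartedSpace (EuclideanSpace ℝ (Fin n)) Ω] :=
  ∀ x : Ω, TangentSpace (𝓡 n) x →L[ℝ] TangentSpace (𝓡 n) x →L[ℝ] ℝ

section

variable {n : ℕ} {Ω : Type*} [TopologicalSpace Ω] [ChartedSpace (EuclideanSpace ℝ (Fin n)) Ω]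

/-- The tensor is symmetric at every point. -/
def IsSymmetric (g : TwoTensor n Ω) : Prop :=
  ∀ (x : Ω) (v w : TangentSpace (𝓡 n) x), g x v w = g x w v

/-- The tensor is positive definite at every point. -/
def IsPosDef (g : TwoTensor n Ω) : Prop :=
  ∀ (x : Ω) (v : TangentSpace (𝓡 n) x), v ≠ 0 → 0 < g x v v

/-- The `i`-th standard basis vector of `ℝⁿ`. -/
def stdVec (n : ℕ) (i : Fin n) : EuclideanSpace ℝ (Fin n) := EuclideanSpace.single i 1

/-- The components `T i j` of a two-tensor at `x`, in the basis of `T_x Ω` which consists of the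
coordinate vectors at `x` of the preferred chart `chartAt x`. (In Mathlib `T_x Ω` is identified with
`ℝⁿ` through this chart, so this basis is the standard basis of `ℝⁿ`.) -/
def coeff (g : TwoTensor n Ω) (x : Ω) : Matrix (Fin n) (Fin n) ℝ :=
  Matrix.of fun i j => g x (stdVec n i) (stdVec n j)

/-- The components of the inverse `g⁻¹` (a contravariant two-tensor) at `x`, in the same basis. -/
def coeffInv (g : TwoTensor n Ω) (x : Ω) : Matrix (Fin n) (Fin n) ℝ :=
  (coeff g x)⁻¹

/-- The norm `|A|_g = (g^{ik} g^{jm} A_{ij} A_{km})^{1/2}` at `x` of a covariant two-tensor given by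
its components `A x`. -/
def covNorm (g : TwoTensor n Ω) (A : Ω → Matrix (Fin n) (Fin n) ℝ) (x : Ω) : ℝ :=
  Real.sqrt (∑ i, ∑ j, ∑ k, ∑ m,
    coeffInv g x i k * coeffInv g x j m * A x i j * A x k m)

/-- The norm `|N|_g = (g_{ik} g_{jm} N^{ij} N^{km})^{1/2}` at `x` of a contravariant two-tensor
given by its components `N x`. -/
def contraNorm (g : TwoTensor n Ω) (N : Ω → Matrix (Fin n) (Fin n) ℝ) (x : Ω) : ℝ :=
  Real.sqrt (∑ i, ∑ j, ∑ k, ∑ m,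
    coeff g x i k * coeff g x j m * N x i j * N x k m)

end

section

variable {n : ℕ} {Ω : Type*} [TopologicalSpace Ω] [ChartedSpace (EuclideanSpace ℝ (Fin n)) Ω]
  [IsManifold (𝓡 n) ∞ Ω]

/-- The components `g_{ij}(y) = g(∂_i, ∂_j)` of a two-tensor in the chart `chartAt c`, as functions
of the coordinates `y ∈ (chartAt c).target ⊆ ℝⁿ`. The coordinate vector `∂_i` of the chart
`chartAt c` at the point `z` with coordinates `y` corresponds, under the identification of `T_z Ω`
with `ℝⁿ` through `chartAt z`, to the image of the `i`-th basis vector under the derivative of the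
transition map from `chartAt c` to `chartAt z`. -/
def chartCoeff (c : Ω) (g : TwoTensor n Ω) (y : EuclideanSpace ℝ (Fin n)) :
    Matrix (Fin n) (Fin n) ℝ :=
  let z : Ω := (chartAt (EuclideanSpace ℝ (Fin n)) c).symm y
  Matrix.of fun i j =>
    g z (tangentCoordChange (𝓡 n) c z z (stdVec n i)) (tangentCoordChange (𝓡 n) c z z (stdVec n j))

/-! ### Ricci curvature and Ricci flow -/

/-- The partial derivative `∂_i f` of a function on `ℝⁿ`. -/
def pderiv (i : Fin n) (f : EuclideanSpace ℝ (Fin n) → ℝ) (y : EuclideanSpace ℝ (Fin n)) : ℝ :=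
  fderiv ℝ f y (stdVec n i)

/-- The Christoffel symbols
`Γ^m_{ij} = (1/2) g^{mk} (∂_i g_{jk} + ∂_j g_{ik} - ∂_k g_{ij})`
of a metric given in coordinates by the matrix function `G`. -/
def christoffel (G : EuclideanSpace ℝ (Fin n) → Matrix (Fin n) (Fin n) ℝ) (m i j : Fin n)
    (y : EuclideanSpace ℝ (Fin n)) : ℝ :=
  (1 / 2 : ℝ) * ∑ k, (G y)⁻¹ m k *
    (pderiv i (fun z => G z j k) y + pderiv j (fun z => G z i k) y
      - pderiv k (fun z => G z i j) y)

/-- The Ricci curvature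
`R_{jk} = ∂_i Γ^i_{jk} - ∂_j Γ^i_{ik} + Γ^i_{ip} Γ^p_{jk} - Γ^i_{jp} Γ^p_{ik}`
of a metric given in coordinates by the matrix function `G`. -/
def coordRicci (G : EuclideanSpace ℝ (Fin n) → Matrix (Fin n) (Fin n) ℝ)
    (y : EuclideanSpace ℝ (Fin n)) : Matrix (Fin n) (Fin n) ℝ :=
  Matrix.of fun j k =>
    ∑ i, (pderiv i (christoffel G i j k) y - pderiv j (christoffel G i i k) y
      + ∑ p, (christoffel G i i p y * christoffel G p j k y
        - christoffel G i j p y * christoffel G p i k y))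

/-- The components of the Ricci tensor `Rc(g)` at `x`, in the coordinate basis of `T_x Ω` given by
`chartAt x`. -/
def ricci (g : TwoTensor n Ω) (x : Ω) : Matrix (Fin n) (Fin n) ℝ :=
  coordRicci (chartCoeff x g) (chartAt (EuclideanSpace ℝ (Fin n)) x x)

/-- `(ℓ(t))_{t ∈ (0,T]}` is a smooth solution to Ricci flow on `Ω`: a family of Riemannian metrics,
smooth jointly in space and time on `Ω × (0,T]`, with `∂ℓ/∂t = -2 Rc(ℓ(t))`
(at `t = T` the derivative is one-sided). The values of `ℓ` outside `(0,T]` are irrelevant. -/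
structure IsRicciFlow (T : ℝ) (ℓ : ℝ → TwoTensor n Ω) : Prop where
  symm : ∀ t ∈ Ioc 0 T, IsSymmetric (ℓ t)
  posDef : ∀ t ∈ Ioc 0 T, IsPosDef (ℓ t)
  smooth : ∀ (c : Ω) (i j : Fin n),
    ContDiffOn ℝ ∞ (fun q : EuclideanSpace ℝ (Fin n) × ℝ => chartCoeff c (ℓ q.2) q.1 i j)
      ((chartAt (EuclideanSpace ℝ (Fin n)) c).target ×ˢ Ioc 0 T)
  flow : ∀ t ∈ Ioc 0 T, ∀ (x : Ω) (i j : Fin n),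
    HasDerivWithinAt (fun τ => coeff (ℓ τ) x i j) (-2 * ricci (ℓ t) x i j) (Ioc 0 T) t

/-- A two-tensor field is (Lebesgue) measurable if its components in every chart are. -/
def IsMeasurableTensor (g : TwoTensor n Ω) : Prop :=
  ∀ (c : Ω) (i j : Fin n),
    AEMeasurable (fun y => chartCoeff c g y i j)
      (volume.restrict (chartAt (EuclideanSpace ℝ (Fin n)) c).target)

end

/-! ### The Riemannian volume measure -/

section

variable (n : ℕ) (Ω : Type*) [TopologicalSpace Ω] [ChartedSpace (EuclideanSpace ℝ (Fin n)) Ω]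
  [SecondCountableTopology Ω] [MeasurableSpace Ω] [BorelSpace Ω]

/-- A second countable manifold is the disjoint union of countably many Borel sets `D c`, `c ∈ S`,
each of which lies in the domain of the chart `chartAt c`. -/
theorem exists_chart_partition : ∃ (S : Set Ω) (D : Ω → Set Ω), S.Countable ∧
    (∀ c ∈ S, MeasurableSet (D c)) ∧
    (∀ c ∈ S, D c ⊆ (chartAt (EuclideanSpace ℝ (Fin n)) c).source) ∧
    S.PairwiseDisjoint D ∧ ⋃ c ∈ S, D c = univ := by
  classical
  obtain ⟨S, hS, hcov⟩ := TopologicalSpace.countable_cover_nhds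
    (fun x : Ω => chart_source_mem_nhds (EuclideanSpace ℝ (Fin n)) x)
  obtain ⟨f, hf⟩ := Set.countable_iff_exists_injOn.1 hS
  refine ⟨S, fun c => (chartAt (EuclideanSpace ℝ (Fin n)) c).source \
    ⋃ d ∈ {d ∈ S | f d < f c}, (chartAt (EuclideanSpace ℝ (Fin n)) d).source, hS, ?_, ?_, ?_, ?_⟩
  · intro c _
    refine (chartAt (EuclideanSpace ℝ (Fin n)) c).open_source.measurableSet.diff ?_
    exact (isOpen_biUnion fun d _ =>
      (chartAt (EuclideanSpace ℝ (Fin n)) d).open_source).measurableSet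
  · intro c _
    exact sdiff_subset
  · have key : ∀ c ∈ S, ∀ d ∈ S, ∀ x,
        x ∈ (chartAt (EuclideanSpace ℝ (Fin n)) d).source \
          ⋃ e ∈ {e ∈ S | f e < f d}, (chartAt (EuclideanSpace ℝ (Fin n)) e).source →
        x ∈ (chartAt (EuclideanSpace ℝ (Fin n)) c).source → ¬ f c < f d := by
      intro c hc d _ x hx hxc hlt
      exact hx.2 (mem_biUnion (show c ∈ {e ∈ S | f e < f d} from ⟨hc, hlt⟩) hxc)
    intro c hc d hd hcd
    refine Set.disjoint_left.2 fun x hxc hxd => ?_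
    have h1 := key c hc d hd x hxd hxc.1
    have h2 := key d hd c hc x hxc hxd.1
    exact hcd (hf hc hd (by omega))
  · refine eq_univ_of_forall fun x => ?_
    have hx : ∃ k, ∃ c ∈ S, f c = k ∧ x ∈ (chartAt (EuclideanSpace ℝ (Fin n)) c).source := by
      have hx' : x ∈ ⋃ c ∈ S, (chartAt (EuclideanSpace ℝ (Fin n)) c).source := hcov ▸ mem_univ x
      obtain ⟨c, hc, hxc⟩ := mem_iUnion₂.1 hx'
      exact ⟨f c, c, hc, rfl, hxc⟩
    obtain ⟨c, hc, hfc, hxc⟩ := Nat.find_spec hx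
    refine mem_iUnion₂.2 ⟨c, hc, hxc, fun hmem => ?_⟩
    obtain ⟨d, hd, hxd⟩ := mem_iUnion₂.1 hmem
    have hlt : f d < Nat.find hx := hfc ▸ hd.2
    exact Nat.find_min hx hlt ⟨d, hd.1, rfl, hxd⟩

/-- The countable set of centres of a chosen partition of `Ω` into Borel pieces of charts. -/
def centres : Set Ω := (exists_chart_partition n Ω).choose

/-- The Borel pieces of that partition. -/
def piece : Ω → Set Ω := (exists_chart_partition n Ω).choose_spec.choose

end

section

variable {n : ℕ} {Ω : Type*} [TopologicalSpace Ω] [ChartedSpace (EuclideanSpace ℝ (Fin n)) Ω]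
  [IsManifold (𝓡 n) ∞ Ω] [MeasurableSpace Ω] [BorelSpace Ω]

/-- The measure `√(det g_{ij}) dy` of the chart `chartAt c`, transported to `Ω`. -/
def chartVol (g : TwoTensor n Ω) (c : Ω) : Measure Ω :=
  ((volume.restrict (chartAt (EuclideanSpace ℝ (Fin n)) c).target).withDensity
    fun y => ENNReal.ofReal (Real.sqrt (chartCoeff c g y).det)).map
      (chartAt (EuclideanSpace ℝ (Fin n)) c).symm

/-- The Riemannian volume measure `dg`: the Borel measure which on Borel subsets of each chart
domain is `√(det g_{ij}) dy`. It is assembled from a countable partition into Borel pieces of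
charts; by the change of variables formula it does not depend on the partition. -/
def vol [SecondCountableTopology Ω] (g : TwoTensor n Ω) : Measure Ω :=
  Measure.sum fun c : centres n Ω => (chartVol g (c : Ω)).restrict (piece n Ω c)

end

end RFlow

end

/-! Fix a point $x$ and a time $t$, and set $u(q)=\mathrm{tr}(\ell(t)^{-1}\ell(q))$ and
$\rho=|\mathrm{Rc}|_{\ell(q)}$. For a tensor $A$ at $x$ both $|A|_{\ell(t)}$ and
$|\mathrm{tr}(\ell(t)^{-1}A)|$ are at most $u(q)\,|A|_{\ell(q)}$ (`tnorm_le_trace_mul`). With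
$\rho\le\varepsilon/q$ the flow equation gives $u'\ge-2\varepsilon u/q$, hence $u(q)\le
n(t/q)^{2\varepsilon}$ for $q\le t$ (`MatrixFlow.trace_le`). The metrics therefore degenerate at
most like a small power of $t/q$.

It follows that $|\ell(r)-\ell(s)|_{\ell(t)}\le F(r)=\int_r^s 2n(t/q)^{2\varepsilon}\rho\,dq$. The
pointwise curvature bound gives $F(q)\le n(t/q)^{2\varepsilon}$. Applying this to $p-1$ of the
factors when $F^p$ is differentiated leaves a bound for $|\ell(r)-\ell(s)|^p_{\ell(t)}$ that is
linear in $\rho$, with weight $(t/q)^{2\varepsilon p}$ (`MatrixFlow.tnorm_sub_rpow_le`). This is why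
an $L^1$ bound on the curvature controls every $L^p$ norm.

Integrating over $\Omega$ by Tonelli, the measure at time $t$ is replaced by the one at time $q$ at
the cost of $(t/q)^{n\varepsilon}$ (`IsSmallFlow.vol_le_smul`). For $(2p+n)\varepsilon\le 3/4$ the
total weight is at most $(t/q)^{3/4}$, so the integral is at most a constant times
$\varepsilon\,t^{3/4}(s^{1/4}-r^{1/4})$ (`IsSmallFlow.lintegral_energy_le`). Parts (i) and (ii)
follow by elementary inequalities. The inverse metrics satisfy an equation of the same form with the
same $\rho$ (`MatrixFlow.inv`), so they obey the same bounds.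

The bound persists down to $r=0$, so for almost every $x$ the weighted time integral is finite and
$\ell(s)$, $\ell(s)^{-1}$ are Cauchy as $s\searrow0$. Convergence of both makes the limit
invertible, hence positive definite. The pointwise estimate passes to the limit and gives $L^p$
convergence; uniqueness is the triangle inequality. -/

noncomputable section

namespace RFlow

/-! ### Linear algebra: tensor norms with respect to a metric. -/

section Matrices

open Matrix

variable {n : ℕ}

/-- The Frobenius norm of a real square matrix. -/
def fro (A : Matrix (Fin n) (Fin n) ℝ) : ℝ := Real.sqrt (∑ i, ∑ j, A i j ^ 2)

/-- The norm of a two-tensor with components `A`, where `H` is the metric on the dual space. -/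
def tnorm (H A : Matrix (Fin n) (Fin n) ℝ) : ℝ :=
  Real.sqrt (∑ i, ∑ j, ∑ k, ∑ m, H i k * H j m * A i j * A k m)

theorem fro_nonneg (A : Matrix (Fin n) (Fin n) ℝ) : 0 ≤ fro A := Real.sqrt_nonneg _

theorem tnorm_nonneg (H A : Matrix (Fin n) (Fin n) ℝ) : 0 ≤ tnorm H A := Real.sqrt_nonneg _

theorem fro_sq (A : Matrix (Fin n) (Fin n) ℝ) : fro A ^ 2 = (A * Aᵀ).trace := by
  rw [fro, Real.sq_sqrt (by positivity)]
  simp [Matrix.trace, Matrix.mul_apply, sq]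

theorem fro_transpose (A : Matrix (Fin n) (Fin n) ℝ) : fro Aᵀ = fro A := by
  rw [fro, fro, Finset.sum_comm]; rfl

section
attribute [local instance] Matrix.frobeniusNormedAddCommGroup Matrix.frobeniusNormedRing

theorem fro_eq_norm (A : Matrix (Fin n) (Fin n) ℝ) : fro A = ‖A‖ := by
  rw [Matrix.frobenius_norm_def, fro, Real.sqrt_eq_rpow]
  simp

theorem fro_mul_le (A B : Matrix (Fin n) (Fin n) ℝ) : fro (A * B) ≤ fro A * fro B := by
  simp only [fro_eq_norm]; exact Matrix.frobenius_norm_mul A B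

theorem fro_add_le (A B : Matrix (Fin n) (Fin n) ℝ) : fro (A + B) ≤ fro A + fro B := by
  simp only [fro_eq_norm]; exact norm_add_le A B

end

theorem abs_trace_mul_transpose_le (A B : Matrix (Fin n) (Fin n) ℝ) :
    |(A * Bᵀ).trace| ≤ fro A * fro B := by
  have key := Finset.sum_mul_sq_le_sq_mul_sq (Finset.univ : Finset (Fin n × Fin n))
    (fun z => A z.1 z.2) (fun z => B z.1 z.2)
  simp only [Fintype.sum_prod_type] at key
  refine abs_le_of_sq_le_sq ?_ (mul_nonneg (fro_nonneg _) (fro_nonneg _))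
  rw [mul_pow, fro, fro, Real.sq_sqrt (by positivity), Real.sq_sqrt (by positivity)]
  simpa [Matrix.trace, Matrix.mul_apply] using key

theorem abs_apply_le_fro (A : Matrix (Fin n) (Fin n) ℝ) (i j : Fin n) : |A i j| ≤ fro A := by
  rw [fro, ← Real.sqrt_sq_eq_abs]
  refine Real.sqrt_le_sqrt ?_
  refine le_trans ?_ (Finset.single_le_sum (f := fun i => ∑ j, A i j ^ 2)
    (fun i _ => by positivity) (Finset.mem_univ i))
  exact Finset.single_le_sum (f := fun j => A i j ^ 2) (fun j _ => by positivity)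
    (Finset.mem_univ j)

/-- The bilinear form which polarises `tnorm H`. -/
def tform (H A B : Matrix (Fin n) (Fin n) ℝ) : ℝ := (H * A * H * Bᵀ).trace

theorem sum_eq_trace (H A : Matrix (Fin n) (Fin n) ℝ) :
    ∑ i, ∑ j, ∑ k, ∑ m, H i k * H j m * A i j * A k m = (H * A * Hᵀ * Aᵀ).trace := by
  simp only [Matrix.trace, Matrix.diag_apply, Matrix.mul_apply, Matrix.transpose_apply,
    Finset.sum_mul]
  refine Finset.sum_congr rfl fun i _ => Finset.sum_congr rfl fun j _ => ?_
  rw [Finset.sum_comm]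
  refine Finset.sum_congr rfl fun m _ => Finset.sum_congr rfl fun k _ => ?_
  ring

/-- When $Q$ is invertible its columns form an orthonormal basis for the metric whose dual is
$QQ^T$. Properties of `tnorm` thereby reduce to those of the Frobenius norm. -/
theorem tnorm_mul_transpose (Q A : Matrix (Fin n) (Fin n) ℝ) :
    tnorm (Q * Qᵀ) A = fro (Qᵀ * A * Q) := by
  rw [tnorm, sum_eq_trace, ← Real.sqrt_sq (fro_nonneg (Qᵀ * A * Q)), fro_sq]
  congr 1
  simp only [Matrix.transpose_mul, Matrix.transpose_transpose]
  rw [show Q * Qᵀ * A * (Q * Qᵀ) * Aᵀ = Q * (Qᵀ * A * Q * Qᵀ * Aᵀ) by simp only [Matrix.mul_assoc],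
    Matrix.trace_mul_comm]
  simp only [Matrix.mul_assoc]

theorem tform_mul_transpose (Q A B : Matrix (Fin n) (Fin n) ℝ) :
    tform (Q * Qᵀ) A B = (Qᵀ * A * Q * (Qᵀ * B * Q)ᵀ).trace := by
  rw [tform]
  simp only [Matrix.transpose_mul, Matrix.transpose_transpose]
  rw [show Q * Qᵀ * A * (Q * Qᵀ) * Bᵀ = Q * (Qᵀ * A * Q * Qᵀ * Bᵀ) by simp only [Matrix.mul_assoc],
    Matrix.trace_mul_comm]
  simp only [Matrix.mul_assoc]

open scoped MatrixOrder in
theorem exists_eq_mul_transpose {H : Matrix (Fin n) (Fin n) ℝ} (hH : H.PosDef) :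
    ∃ Q : Matrix (Fin n) (Fin n) ℝ, IsUnit Q.det ∧ H = Q * Qᵀ := by
  obtain ⟨B, hB, h⟩ := CStarAlgebra.isStrictlyPositive_iff_eq_mul_star_self.1 hH.isStrictlyPositive
  refine ⟨B, (Matrix.isUnit_iff_isUnit_det _).1 hB, ?_⟩
  rw [h, Matrix.star_eq_conjTranspose, Matrix.conjTranspose_eq_transpose_of_trivial]

theorem tnorm_neg (H A : Matrix (Fin n) (Fin n) ℝ) : tnorm H (-A) = tnorm H A := by
  simp [tnorm]

theorem tnorm_sub_comm (H A B : Matrix (Fin n) (Fin n) ℝ) : tnorm H (A - B) = tnorm H (B - A) := by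
  rw [← neg_sub, tnorm_neg]

theorem tnorm_add_le {H : Matrix (Fin n) (Fin n) ℝ} (hH : H.PosDef)
    (A B : Matrix (Fin n) (Fin n) ℝ) : tnorm H (A + B) ≤ tnorm H A + tnorm H B := by
  obtain ⟨Q, -, rfl⟩ := exists_eq_mul_transpose hH
  simp only [tnorm_mul_transpose, Matrix.mul_add, Matrix.add_mul]
  exact fro_add_le _ _

theorem abs_tform_le {H : Matrix (Fin n) (Fin n) ℝ} (hH : H.PosDef)
    (A B : Matrix (Fin n) (Fin n) ℝ) : |tform H A B| ≤ tnorm H A * tnorm H B := by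
  obtain ⟨Q, -, rfl⟩ := exists_eq_mul_transpose hH
  simp only [tnorm_mul_transpose, tform_mul_transpose]
  exact abs_trace_mul_transpose_le _ _

theorem tform_self {H : Matrix (Fin n) (Fin n) ℝ} (hH : H.PosDef)
    (A : Matrix (Fin n) (Fin n) ℝ) : tform H A A = tnorm H A ^ 2 := by
  obtain ⟨Q, -, rfl⟩ := exists_eq_mul_transpose hH
  rw [tnorm_mul_transpose, tform_mul_transpose, fro_sq]

theorem tnorm_eq_zero {H : Matrix (Fin n) (Fin n) ℝ} (hH : H.PosDef)
    {A : Matrix (Fin n) (Fin n) ℝ} (h : tnorm H A = 0) : A = 0 := by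
  obtain ⟨Q, hQ, rfl⟩ := exists_eq_mul_transpose hH
  rw [tnorm_mul_transpose] at h
  have h0 : Qᵀ * A * Q = 0 := by
    ext i j
    have := abs_apply_le_fro (Qᵀ * A * Q) i j
    rw [h] at this
    simpa using abs_nonpos_iff.1 this
  have hQ' : IsUnit Qᵀ.det := by simpa using hQ
  have : (Qᵀ)⁻¹ * (Qᵀ * A * Q) * Q⁻¹ = A := by
    rw [Matrix.mul_assoc Qᵀ, Matrix.nonsing_inv_mul_cancel_left _ _ hQ',
      Matrix.mul_nonsing_inv_cancel_right _ _ hQ]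
  rw [← this, h0]; simp

/-- The norms transform well under a change of basis. -/
theorem tnorm_congr_inv {P : Matrix (Fin n) (Fin n) ℝ} (hP : IsUnit P.det)
    {G : Matrix (Fin n) (Fin n) ℝ} (A : Matrix (Fin n) (Fin n) ℝ) :
    tnorm (Pᵀ * G * P)⁻¹ (Pᵀ * A * P) = tnorm G⁻¹ A := by
  have hP' : IsUnit Pᵀ.det := by simpa using hP
  rw [tnorm, tnorm, sum_eq_trace, sum_eq_trace]
  congr 1
  have e : (Pᵀ * G * P)⁻¹ * (Pᵀ * A * P) * ((Pᵀ * G * P)⁻¹)ᵀ * (Pᵀ * A * P)ᵀ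
      = P⁻¹ * (G⁻¹ * A * G⁻¹ᵀ * Aᵀ * P) := by
    have hPt : (P⁻¹)ᵀ = (Pᵀ)⁻¹ := Matrix.transpose_nonsing_inv P
    have hPt' : ((Pᵀ)⁻¹)ᵀ = P⁻¹ := by rw [← hPt, Matrix.transpose_transpose]
    rw [Matrix.mul_inv_rev, Matrix.mul_inv_rev]
    simp only [Matrix.transpose_mul, Matrix.transpose_transpose, hPt, hPt']
    simp only [Matrix.mul_assoc, Matrix.mul_nonsing_inv_cancel_left _ _ hP,
      Matrix.nonsing_inv_mul_cancel_left _ _ hP']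
  rw [e, Matrix.trace_mul_comm, Matrix.mul_assoc, Matrix.mul_nonsing_inv _ hP, Matrix.mul_one]

/-- Comparison of the norms and traces of `A` with respect to two metrics. -/
theorem tnorm_le_trace_mul {H G : Matrix (Fin n) (Fin n) ℝ} (hH : H.PosDef) (hG : G.PosDef)
    (A : Matrix (Fin n) (Fin n) ℝ) :
    tnorm H A ≤ (H * G).trace * tnorm G⁻¹ A ∧ |(H * A).trace| ≤ (H * G).trace * tnorm G⁻¹ A := by
  obtain ⟨Q, -, rfl⟩ := exists_eq_mul_transpose hH
  obtain ⟨S, hS, hGS⟩ := exists_eq_mul_transpose hG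
  have hS' : IsUnit Sᵀ.det := by simpa using hS
  -- The components of `A` in a `G`-orthonormal basis.
  set B := S⁻¹ * A * (S⁻¹)ᵀ with hB
  have hA : A = S * B * Sᵀ := by
    simp only [hB, Matrix.transpose_nonsing_inv, Matrix.mul_assoc,
      Matrix.mul_nonsing_inv_cancel_left _ _ hS, Matrix.nonsing_inv_mul _ hS', Matrix.mul_one]
  have h1 : tnorm G⁻¹ A = fro B := by
    rw [hGS, Matrix.mul_inv_rev]
    have := tnorm_mul_transpose (S⁻¹)ᵀ A
    rw [Matrix.transpose_transpose] at this
    rw [← Matrix.transpose_nonsing_inv, this]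
  -- The transition between the two orthonormal frames; its squared Frobenius norm is the trace of
  -- `H * G`, so each use of `X` costs a square root of that trace.
  set X := Qᵀ * S with hX
  have h2 : (Q * Qᵀ * G).trace = fro X ^ 2 := by
    rw [fro_sq, hX, hGS, Matrix.mul_assoc, Matrix.trace_mul_comm]
    simp only [Matrix.transpose_mul, Matrix.transpose_transpose, Matrix.mul_assoc]
  have h3 : fro (Xᵀ * X) ≤ fro X ^ 2 := by
    refine (fro_mul_le _ _).trans_eq ?_
    rw [fro_transpose, sq]
  rw [h1, h2]
  constructor
  · rw [tnorm_mul_transpose, hA]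
    have : Qᵀ * (S * B * Sᵀ) * Q = X * B * Xᵀ := by
      simp only [hX, Matrix.transpose_mul, Matrix.transpose_transpose, Matrix.mul_assoc]
    rw [this]
    calc fro (X * B * Xᵀ) ≤ fro (X * B) * fro Xᵀ := fro_mul_le _ _
      _ ≤ fro X * fro B * fro Xᵀ := by
        gcongr
        · exact fro_nonneg _
        · exact fro_mul_le _ _
      _ = fro X ^ 2 * fro B := by rw [fro_transpose]; ring
  · have : (Q * Qᵀ * A).trace = (B * (Xᵀ * X)ᵀ).trace := by
      rw [hA, show Q * Qᵀ * (S * B * Sᵀ) = Q * (Qᵀ * S * B) * Sᵀ by simp only [Matrix.mul_assoc],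
        Matrix.trace_mul_comm, ← Matrix.mul_assoc, Matrix.trace_mul_comm]
      simp only [hX, Matrix.transpose_mul, Matrix.transpose_transpose, ← Matrix.mul_assoc]
      rw [Matrix.mul_assoc _ _ Q, Matrix.mul_assoc, Matrix.trace_mul_comm]
      simp only [Matrix.mul_assoc]
    rw [this]
    refine (abs_trace_mul_transpose_le _ _).trans ?_
    rw [mul_comm]
    exact mul_le_mul_of_nonneg_right h3 (fro_nonneg _)

theorem trace_mul_nonneg {H G : Matrix (Fin n) (Fin n) ℝ} (hH : H.PosDef) (hG : G.PosDef) :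
    0 ≤ (H * G).trace := by
  obtain ⟨Q, -, rfl⟩ := exists_eq_mul_transpose hH
  obtain ⟨S, -, rfl⟩ := exists_eq_mul_transpose hG
  have : (Q * Qᵀ * (S * Sᵀ)).trace = fro (Qᵀ * S) ^ 2 := by
    rw [fro_sq, Matrix.mul_assoc, Matrix.trace_mul_comm]
    simp only [Matrix.transpose_mul, Matrix.transpose_transpose, Matrix.mul_assoc]
  rw [this]
  positivity

/-- The left side is the determinant of $XX^T$ with $|X|^2=\mathrm{tr}(HG)$, so every entry is at
most this trace and the Leibniz expansion has $n!$ terms. The crude constant is harmless: only the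
power of the trace matters for comparing volumes. -/
theorem det_le_of_trace {H G : Matrix (Fin n) (Fin n) ℝ} (hH : H.PosDef) (hG : G.PosDef) :
    H.det * G.det ≤ n.factorial * (H * G).trace ^ n := by
  obtain ⟨Q, -, rfl⟩ := exists_eq_mul_transpose hH
  obtain ⟨S, hS, rfl⟩ := exists_eq_mul_transpose hG
  set X := Qᵀ * S with hX
  have h2 : (Q * Qᵀ * (S * Sᵀ)).trace = fro X ^ 2 := by
    rw [fro_sq, hX, Matrix.mul_assoc, Matrix.trace_mul_comm]
    simp only [Matrix.transpose_mul, Matrix.transpose_transpose, Matrix.mul_assoc]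
  have h3 : fro (X * Xᵀ) ≤ fro X ^ 2 := by
    refine (fro_mul_le _ _).trans_eq ?_
    rw [fro_transpose, sq]
  have h4 : (Q * Qᵀ).det * (S * Sᵀ).det = (X * Xᵀ).det := by
    simp only [hX, Matrix.det_mul, Matrix.det_transpose]; ring
  rw [h4, h2]
  have := Matrix.det_le (A := X * Xᵀ) (abv := AbsoluteValue.abs) (x := fro X ^ 2)
    (fun i j => (abs_apply_le_fro _ i j).trans h3)
  refine (le_abs_self _).trans ?_
  simpa using this

theorem tnorm_inv_self {G : Matrix (Fin n) (Fin n) ℝ} (hG : G.PosDef) :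
    tnorm G⁻¹ G = Real.sqrt n := by
  have h : IsUnit G.det := (Matrix.isUnit_iff_isUnit_det _).1 hG.isUnit
  rw [← Real.sqrt_sq (tnorm_nonneg G⁻¹ G), ← tform_self hG.inv, tform,
    Matrix.nonsing_inv_mul _ h, Matrix.one_mul, ← Matrix.conjTranspose_eq_transpose_of_trivial,
    hG.isHermitian.eq, Matrix.nonsing_inv_mul _ h]
  simp

end Matrices
-- Pointwise estimates along the flow, at a fixed point of the manifold.
section Evolution

open Matrix

theorem continuousWithinAt_matrix_inv {X : Type*} [TopologicalSpace X] {n : ℕ}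
    {f : X → Matrix (Fin n) (Fin n) ℝ} {S : Set X} {x : X} (hf : ContinuousWithinAt f S x)
    (hx : (f x).det ≠ 0) : ContinuousWithinAt (fun y => (f y)⁻¹) S x := by
  have hd : ContinuousWithinAt (fun y => (f y).det) S x :=
    (continuous_id.matrix_det (R := ℝ)).continuousAt.comp_continuousWithinAt hf
  have ha : ContinuousWithinAt (fun y => (f y).adjugate) S x :=
    (continuous_id.matrix_adjugate (R := ℝ)).continuousAt.comp_continuousWithinAt hf
  simp only [Matrix.inv_def, Ring.inverse_eq_inv']
  exact (hd.inv₀ hx).smul ha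

/-- Comparison backwards in time: $f-g$ is nondecreasing, so its sign at the later endpoint passes
to the earlier one. -/
theorem le_of_hasDerivAt_ge {f g f' g' : ℝ → ℝ} {r s : ℝ} (hrs : r ≤ s)
    (hf : ContinuousOn f (Icc r s)) (hg : ContinuousOn g (Icc r s))
    (hf' : ∀ q ∈ Ioo r s, HasDerivAt f (f' q) q) (hg' : ∀ q ∈ Ioo r s, HasDerivAt g (g' q) q)
    (h : ∀ q ∈ Ioo r s, g' q ≤ f' q) (hs : f s ≤ g s) : f r ≤ g r := by
  have hmono : MonotoneOn (fun q => f q - g q) (Icc r s) := by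
    refine monotoneOn_of_hasDerivWithinAt_nonneg (f' := fun q => f' q - g' q)
      (convex_Icc r s) (hf.sub hg) (fun q hq => ?_) (fun q hq => ?_)
    · rw [interior_Icc] at hq ⊢
      exact ((hf' q hq).sub (hg' q hq)).hasDerivWithinAt
    · rw [interior_Icc] at hq
      exact sub_nonneg.2 (h q hq)
  have := hmono (left_mem_Icc.2 hrs) (right_mem_Icc.2 hrs) hrs
  simp only at this
  linarith

/-- The power $(t/q)^a$ solves $f'=-af/q$, the extremal case of the inequalities that a curvature
bound $\varepsilon/q$ produces. -/
theorem hasDerivAt_weight {t a q : ℝ} (ht : 0 < t) (hq : 0 < q) :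
    HasDerivAt (fun q => (t / q) ^ a) (-(a * (t / q) ^ a / q)) q := by
  have h1 : HasDerivAt (fun q : ℝ => t / q) (-t / q ^ 2) q := by
    simpa using (hasDerivAt_const q t).fun_div (hasDerivAt_id' q) hq.ne'
  have h2 := h1.rpow_const (p := a) (Or.inl (div_pos ht hq).ne')
  convert h2 using 1
  have hd : 0 < t / q := div_pos ht hq
  rw [Real.rpow_sub_one hd.ne']
  field_simp

theorem continuousOn_weight {t a r s : ℝ} (ht : 0 < t) (hr : 0 < r) :
    ContinuousOn (fun q => (t / q) ^ a) (Icc r s) := fun _ hq =>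
  (hasDerivAt_weight ht (hr.trans_le hq.1)).continuousAt.continuousWithinAt

/-- A matrix-valued solution `G` of `G' = -2 R` on `(0, T]` with `|R|_G ≤ ε / t`. -/
structure MatrixFlow {n : ℕ} (T ε : ℝ) (G R : ℝ → Matrix (Fin n) (Fin n) ℝ) : Prop where
  eps_nonneg : 0 ≤ ε
  posDef : ∀ q ∈ Ioc 0 T, (G q).PosDef
  deriv : ∀ q ∈ Ioc 0 T, ∀ i j,
    HasDerivWithinAt (fun τ => G τ i j) (-2 * R q i j) (Ioc 0 T) q
  cont : ContinuousOn (fun q => tnorm (G q)⁻¹ (R q)) (Ioc 0 T)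
  bound : ∀ q ∈ Ioc 0 T, tnorm (G q)⁻¹ (R q) ≤ ε / q

variable {n : ℕ} {T ε : ℝ} {G R : ℝ → Matrix (Fin n) (Fin n) ℝ}

namespace MatrixFlow

theorem isUnit_det (h : MatrixFlow T ε G R) {q : ℝ} (hq : q ∈ Ioc 0 T) : IsUnit (G q).det :=
  (Matrix.isUnit_iff_isUnit_det _).1 (h.posDef q hq).isUnit

/-- The derivative of a linear functional of the solution. -/
theorem hasDerivWithinAt_trace_mul (h : MatrixFlow T ε G R) (W : Matrix (Fin n) (Fin n) ℝ)
    {q : ℝ} (hq : q ∈ Ioc 0 T) :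
    HasDerivWithinAt (fun τ => (W * G τ).trace) (-2 * (W * R q).trace) (Ioc 0 T) q := by
  simp only [Matrix.trace, Matrix.diag_apply, Matrix.mul_apply, Finset.mul_sum]
  refine HasDerivWithinAt.fun_sum fun i _ => HasDerivWithinAt.fun_sum fun j _ => ?_
  rw [mul_left_comm]
  exact (h.deriv q hq j i).const_mul (W i j)

theorem continuousOn_trace_mul (h : MatrixFlow T ε G R) (W : Matrix (Fin n) (Fin n) ℝ) :
    ContinuousOn (fun τ => (W * G τ).trace) (Ioc 0 T) := fun _ hq =>
  (h.hasDerivWithinAt_trace_mul W hq).continuousWithinAt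

theorem hasDerivAt_trace_mul (h : MatrixFlow T ε G R) (W : Matrix (Fin n) (Fin n) ℝ)
    {q : ℝ} (hq : q ∈ Ioo 0 T) :
    HasDerivAt (fun τ => (W * G τ).trace) (-2 * (W * R q).trace) q :=
  (h.hasDerivWithinAt_trace_mul W (Ioo_subset_Ioc_self hq)).hasDerivAt (Ioc_mem_nhds hq.1 hq.2)

/-- By `tnorm_le_trace_mul` the trace $u$ satisfies $u'\ge-2\varepsilon u/q$. Hence
$u(q)(t/q)^{-2\varepsilon}$ is nondecreasing, and it equals $n$ at $q=t$. -/
theorem trace_le (h : MatrixFlow T ε G R) {r t : ℝ} (hr : 0 < r) (hrt : r ≤ t) (ht : t ≤ T) :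
    ((G t)⁻¹ * G r).trace ≤ n * (t / r) ^ (2 * ε) := by
  have ht0 : 0 < t := hr.trans_le hrt
  have htT : t ∈ Ioc 0 T := ⟨ht0, ht⟩
  have hsub : Icc r t ⊆ Ioc 0 T := fun q hq => ⟨hr.trans_le hq.1, hq.2.trans ht⟩
  set W := (G t)⁻¹ with hW
  have hWp : W.PosDef := (h.posDef t htT).inv
  set u := fun q => (W * G q).trace with hu
  have hw (q : ℝ) (hq : q ∈ Icc r t) : 0 < (t / q) ^ (2 * ε) :=
    Real.rpow_pos_of_pos (div_pos ht0 (hr.trans_le hq.1)) _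
  have key : u r * (t / r) ^ (-(2 * ε)) ≤ n := by
    refine le_of_hasDerivAt_ge (f := fun q => u q * (t / q) ^ (-(2 * ε))) (g := fun _ => (n : ℝ))
      (f' := fun q => -2 * (W * R q).trace * (t / q) ^ (-(2 * ε))
        + u q * -(-(2 * ε) * (t / q) ^ (-(2 * ε)) / q)) (g' := fun _ => 0) hrt
      (((h.continuousOn_trace_mul W).mono hsub).mul (continuousOn_weight ht0 hr))
      continuousOn_const (fun q hq => ?_) (fun q _ => hasDerivAt_const _ _) (fun q hq => ?_) ?_
    · exact (h.hasDerivAt_trace_mul W ⟨hr.trans hq.1, hq.2.trans_le ht⟩).mul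
        (hasDerivAt_weight ht0 (hr.trans hq.1))
    · have hq' := hsub (Ioo_subset_Icc_self hq)
      have h1 := (tnorm_le_trace_mul hWp (h.posDef q hq') (R q)).2
      have h2 : 0 ≤ u q := trace_mul_nonneg hWp (h.posDef q hq')
      have h3 : (W * R q).trace ≤ u q * (ε / q) :=
        ((le_abs_self _).trans h1).trans (mul_le_mul_of_nonneg_left (h.bound q hq') h2)
      have h4 : 0 ≤ (t / q) ^ (-(2 * ε)) :=
        (Real.rpow_pos_of_pos (div_pos ht0 hq'.1) _).le
      have : -2 * (W * R q).trace * (t / q) ^ (-(2 * ε))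
        + u q * -(-(2 * ε) * (t / q) ^ (-(2 * ε)) / q)
        = 2 * (t / q) ^ (-(2 * ε)) * (u q * (ε / q) - (W * R q).trace) := by ring
      rw [this]
      exact mul_nonneg (by positivity) (sub_nonneg.2 h3)
    · simp [hu, hW, Matrix.nonsing_inv_mul _ (h.isUnit_det htT), ht0.ne']
  have hp := hw r (left_mem_Icc.2 hrt)
  rw [Real.rpow_neg (by positivity), ← div_eq_mul_inv, div_le_iff₀ hp] at key
  exact key

/-- The point is that the integrand is linear in the curvature norm. The other $p-1$ factors are
absorbed by the pointwise bound, which raises the weight exponent from $2\varepsilon$ to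
$2\varepsilon p$. -/
theorem tnorm_sub_rpow_le (h : MatrixFlow T ε G R) {p : ℝ} (hp : 2 ≤ p) {r s t : ℝ} (hr : 0 < r)
    (hrs : r ≤ s) (hst : s ≤ t) (ht : t ≤ T) :
    tnorm (G t)⁻¹ (G r - G s) ^ p ≤
      ∫ q in r..s, 2 * p * (n : ℝ) ^ p * ((t / q) ^ (2 * ε * p) * tnorm (G q)⁻¹ (R q)) := by
  have hs0 : 0 < s := hr.trans_le hrs
  have ht0 : 0 < t := hs0.trans_le hst
  have htT : t ∈ Ioc 0 T := ⟨ht0, ht⟩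
  have hsub : Icc r s ⊆ Ioc 0 T := fun q hq => ⟨hr.trans_le hq.1, (hq.2.trans hst).trans ht⟩
  set W := (G t)⁻¹ with hW
  have hWp : W.PosDef := (h.posDef t htT).inv
  set ρ := fun q => tnorm (G q)⁻¹ (R q) with hρ
  have hρc : ContinuousOn ρ (Icc r s) := h.cont.mono hsub
  have hρ0 (q : ℝ) : 0 ≤ ρ q := tnorm_nonneg _ _
  have hprim {k : ℝ → ℝ} (hk : ContinuousOn k (Icc r s)) :
      ContinuousOn (fun q => ∫ τ in q..s, k τ) (Icc r s) ∧
      ∀ q ∈ Ioo r s, HasDerivAt (fun q => ∫ τ in q..s, k τ) (-k q) q := by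
    have hint : IntegrableOn k (uIcc r s) := by
      rw [uIcc_of_le hrs]; exact hk.integrableOn_Icc
    refine ⟨?_, fun q hq => ?_⟩
    · have := intervalIntegral.continuousOn_primitive_interval_left (b := s) hint
      rwa [uIcc_of_le hrs] at this
    · refine intervalIntegral.integral_hasDerivAt_left ?_
        (hk.mono Ioo_subset_Icc_self |>.stronglyMeasurableAtFilter isOpen_Ioo q hq)
        (hk.continuousAt (Icc_mem_nhds hq.1 hq.2))
      exact ((hk.mono (Icc_subset_Icc_left hq.1.le)).intervalIntegrable_of_Icc hq.2.le)
  have hkc : ContinuousOn (fun q => 2 * n * (t / q) ^ (2 * ε) * ρ q) (Icc r s) :=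
    (continuousOn_const.mul (continuousOn_weight ht0 hr)).mul hρc
  set k := fun q => 2 * n * (t / q) ^ (2 * ε) * ρ q with hk
  set F := fun q => ∫ τ in q..s, k τ with hF
  have hFs : F s = 0 := intervalIntegral.integral_same
  have hw (q : ℝ) (hq : q ∈ Icc r s) : 0 < (t / q) ^ (2 * ε) :=
    Real.rpow_pos_of_pos (div_pos ht0 (hr.trans_le hq.1)) _
  have hk0 (q : ℝ) (hq : q ∈ Icc r s) : 0 ≤ k q := by
    have := (hw q hq).le
    have := hρ0 q
    simp only [hk]
    positivity
  have hF0 (q : ℝ) (hq : q ∈ Icc r s) : 0 ≤ F q :=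
    intervalIntegral.integral_nonneg hq.2 fun τ hτ => hk0 τ ⟨hq.1.trans hτ.1, hτ.2⟩
  -- the difference is bounded by the primitive
  have h1 : tnorm W (G r - G s) ≤ F r := by
    -- The norm of the difference is recovered by pairing with the fixed matrix `D`: the pairing is
    -- linear in `G q`, so its derivative is explicit, and no norm has to be differentiated.
    set D := G r - G s with hD
    set d := tnorm W D with hd
    have hlin (A : Matrix (Fin n) (Fin n) ℝ) : tform W A D = (W * Dᵀ * W * A).trace := by
      rw [tform, show W * A * W * Dᵀ = (W * A) * (W * Dᵀ) by simp only [Matrix.mul_assoc],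
        Matrix.trace_mul_comm]
      simp only [Matrix.mul_assoc]
    have hle : tform W (G r) D - tform W (G s) D ≤ d * F r := by
      refine le_of_hasDerivAt_ge (f := fun q => tform W (G q) D - tform W (G s) D)
        (g := fun q => d * F q) (f' := fun q => -2 * tform W (R q) D) (g' := fun q => d * -k q)
        hrs ?_ (continuousOn_const.mul (hprim hkc).1) (fun q hq => ?_)
        (fun q hq => ((hprim hkc).2 q hq).const_mul d) (fun q hq => ?_) (by simp [hFs])
      · simp only [hlin]
        exact ((h.continuousOn_trace_mul _).mono hsub).sub continuousOn_const
      · simp only [hlin]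
        exact (h.hasDerivAt_trace_mul _
          ⟨hr.trans hq.1, (hq.2.trans_le hst).trans_le ht⟩).sub_const _
      · have hq' := Ioo_subset_Icc_self hq
        have e1 := (le_abs_self _).trans (abs_tform_le hWp (R q) D)
        have e2 := (tnorm_le_trace_mul hWp (h.posDef q (hsub hq')) (R q)).1
        have e3 := h.trace_le (hsub hq').1 (hq.2.le.trans hst) ht
        have e4 : tnorm W (R q) ≤ n * (t / q) ^ (2 * ε) * ρ q :=
          e2.trans (mul_le_mul_of_nonneg_right e3 (hρ0 q))
        have e5 := mul_le_mul_of_nonneg_right e4 (tnorm_nonneg W D)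
        simp only [hk]
        rw [← hd] at e1 e5
        linarith
    have hdd : tform W (G r) D - tform W (G s) D = d * d := by
      rw [hlin, hlin, ← Matrix.trace_sub, ← Matrix.mul_sub, ← hlin, tform_self hWp, sq]
    rw [hdd] at hle
    rcases (tnorm_nonneg W D).eq_or_lt with h0 | h0
    · rw [hd, ← h0]; exact hF0 r (left_mem_Icc.2 hrs)
    · exact le_of_mul_le_mul_left hle h0
  -- the primitive is bounded by the weight
  have h2 (q : ℝ) (hq : q ∈ Icc r s) : F q ≤ n * (t / q) ^ (2 * ε) := by
    have hq0 : 0 < q := hr.trans_le hq.1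
    have hqs : Icc q s ⊆ Icc r s := Icc_subset_Icc_left hq.1
    refine le_of_hasDerivAt_ge (f := F) (g := fun q => n * (t / q) ^ (2 * ε))
      (f' := fun q => -k q) (g' := fun q => n * -(2 * ε * (t / q) ^ (2 * ε) / q))
      hq.2 ((hprim hkc).1.mono hqs) (continuousOn_const.mul (continuousOn_weight ht0 hq0))
      (fun τ hτ => (hprim hkc).2 τ ⟨hq.1.trans_lt hτ.1, hτ.2⟩)
      (fun τ hτ => (hasDerivAt_weight ht0 (hq0.trans hτ.1)).const_mul _) (fun τ hτ => ?_) ?_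
    · have hτ' := hqs (Ioo_subset_Icc_self hτ)
      have e1 := h.bound τ (hsub hτ')
      have e2 := mul_le_mul_of_nonneg_left e1
        (mul_nonneg (n.cast_nonneg : (0 : ℝ) ≤ n) (hw τ hτ').le)
      simp only [hk, hρ]
      have e3 : n * -(2 * ε * (t / τ) ^ (2 * ε) / τ) = -(2 * (n * (t / τ) ^ (2 * ε) * (ε / τ))) := by
        ring
      rw [e3]; linarith
    · rw [hFs]; exact mul_nonneg n.cast_nonneg (hw s (right_mem_Icc.2 hrs)).le
  -- integrate the derivative of the power
  have hkc' : ContinuousOn (fun q => 2 * p * (n : ℝ) ^ p * ((t / q) ^ (2 * ε * p) * ρ q))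
      (Icc r s) := continuousOn_const.mul ((continuousOn_weight ht0 hr).mul hρc)
  have h3 : F r ^ p ≤ ∫ q in r..s, 2 * p * (n : ℝ) ^ p * ((t / q) ^ (2 * ε * p) * ρ q) := by
    refine le_of_hasDerivAt_ge (f := fun q => F q ^ p) (f' := fun q => -k q * p * F q ^ (p - 1))
      hrs ((hprim hkc).1.rpow_const fun q _ => Or.inr (by linarith)) (hprim hkc').1
      (fun q hq => ((hprim hkc).2 q hq).rpow_const (Or.inr (by linarith)))
      (hprim hkc').2 (fun q hq => ?_) ?_
    · have hq' := Ioo_subset_Icc_self hq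
      have e1 : F q ^ (p - 1) ≤ (n * (t / q) ^ (2 * ε)) ^ (p - 1) :=
        Real.rpow_le_rpow (hF0 q hq') (h2 q hq') (by linarith)
      have hb : 0 ≤ n * (t / q) ^ (2 * ε) := mul_nonneg n.cast_nonneg (hw q hq').le
      -- One factor comes from `k` and $p-1$ from the bound on `F`, giving exactly the $p$-th power.
      have e2 : n * (t / q) ^ (2 * ε) * (n * (t / q) ^ (2 * ε)) ^ (p - 1)
          = (n : ℝ) ^ p * (t / q) ^ (2 * ε * p) := by
        rw [mul_comm, ← Real.rpow_add_one' hb (by linarith), sub_add_cancel,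
          Real.mul_rpow n.cast_nonneg (hw q hq').le,
          ← Real.rpow_mul (div_pos ht0 (hsub hq').1).le]
      have e3 : 2 * p * (n : ℝ) ^ p * ((t / q) ^ (2 * ε * p) * ρ q)
          = k q * p * (n * (t / q) ^ (2 * ε)) ^ (p - 1) := by
        rw [← mul_assoc, mul_assoc (2 * p), ← e2]; simp only [hk]; ring
      rw [e3]
      have e4 := mul_le_mul_of_nonneg_left e1
        (mul_nonneg (hk0 q hq') (by linarith : (0 : ℝ) ≤ p))
      linarith
    · simp only [hFs, intervalIntegral.integral_same]
      rw [Real.zero_rpow (by linarith)]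
  exact (Real.rpow_le_rpow (tnorm_nonneg _ _) h1 (by linarith)).trans h3

/-- The inverse matrices solve an equation of the same kind. -/
theorem inv (h : MatrixFlow T ε G R) :
    MatrixFlow T ε (fun q => (G q)⁻¹) (fun q => -((G q)⁻¹ * R q * (G q)⁻¹)) ∧
    ∀ q ∈ Ioc 0 T, tnorm ((G q)⁻¹)⁻¹ (-((G q)⁻¹ * R q * (G q)⁻¹)) = tnorm (G q)⁻¹ (R q) := by
  have hnorm : ∀ q ∈ Ioc 0 T,
      tnorm ((G q)⁻¹)⁻¹ (-((G q)⁻¹ * R q * (G q)⁻¹)) = tnorm (G q)⁻¹ (R q) := fun q hq => by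
    have hu := h.isUnit_det hq
    have hs : ((G q)⁻¹)ᵀ = (G q)⁻¹ := by
      rw [← Matrix.conjTranspose_eq_transpose_of_trivial, (h.posDef q hq).inv.isHermitian.eq]
    -- Raising both indices is the change of basis by $G^{-1}$, which carries $G$ to $G^{-1}$ and
    -- $R$ to $G^{-1}RG^{-1}$.
    have := tnorm_congr_inv (P := (G q)⁻¹) (by simpa using hu.ne_zero) (G := G q) (R q)
    rwa [hs, Matrix.nonsing_inv_mul _ hu, Matrix.one_mul, ← tnorm_neg] at this
  refine ⟨⟨h.eps_nonneg, fun q hq => (h.posDef q hq).inv, fun q hq i j => ?_,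
    h.cont.congr hnorm, fun q hq => (hnorm q hq).trans_le (h.bound q hq)⟩, hnorm⟩
  have hcG : ContinuousWithinAt G (Ioc 0 T) q :=
    continuousWithinAt_pi.2 fun i => continuousWithinAt_pi.2 fun j =>
      (h.deriv q hq i j).continuousWithinAt
  have hcM : ContinuousWithinAt (fun τ => (G τ)⁻¹) (Ioc 0 T) q := continuousWithinAt_matrix_inv hcG
    (h.isUnit_det hq).ne_zero
  -- Difference quotients are computed from
  -- $G(\tau)^{-1}-G(q)^{-1}=-G(\tau)^{-1}(G(\tau)-G(q))G(q)^{-1}$, which needs only continuity of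
  -- the inverse.
  rw [hasDerivWithinAt_iff_tendsto_slope]
  have hmono : 𝓝[Ioc 0 T \ {q}] q ≤ 𝓝[Ioc 0 T] q := nhdsWithin_mono _ sdiff_subset
  have hlim : Tendsto (fun τ => -∑ l, (∑ k, (G τ)⁻¹ i k * slope (fun τ => G τ k l) q τ)
      * (G q)⁻¹ l j) (𝓝[Ioc 0 T \ {q}] q)
      (𝓝 (-∑ l, (∑ k, (G q)⁻¹ i k * (-2 * R q k l)) * (G q)⁻¹ l j)) := by
    refine (tendsto_finsetSum _ fun l _ => (tendsto_finsetSum _ fun k _ => ?_).mul_const _).neg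
    refine Tendsto.mul ?_ (hasDerivWithinAt_iff_tendsto_slope.1 (h.deriv q hq k l))
    exact ((continuous_apply_apply i k).continuousAt.tendsto.comp hcM.tendsto).mono_left hmono
  have e : -∑ l, (∑ k, (G q)⁻¹ i k * (-2 * R q k l)) * (G q)⁻¹ l j
      = -2 * (-((G q)⁻¹ * R q * (G q)⁻¹)) i j := by
    simp only [Matrix.neg_apply, Matrix.mul_apply, Finset.sum_mul, Finset.mul_sum,
      ← Finset.sum_neg_distrib]
    refine Finset.sum_congr rfl fun l _ => Finset.sum_congr rfl fun k _ => ?_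
    ring
  rw [← e]
  refine hlim.congr' ?_
  filter_upwards [self_mem_nhdsWithin] with τ hτ
  have h1 : (G τ)⁻¹ - (G q)⁻¹ = -((G τ)⁻¹ * (G τ - G q) * (G q)⁻¹) := by
    rw [Matrix.mul_sub, Matrix.sub_mul, Matrix.nonsing_inv_mul _ (h.isUnit_det hτ.1),
      Matrix.mul_assoc (G τ)⁻¹, Matrix.mul_nonsing_inv _ (h.isUnit_det hq)]
    simp
  have h2 := congrFun (congrFun h1 i) j
  rw [Matrix.sub_apply] at h2
  rw [slope_def_field, h2]
  simp only [Matrix.neg_apply, Matrix.mul_apply, slope_def_field, Finset.sum_mul, neg_div,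
    Finset.sum_div, Matrix.sub_apply]
  congr 1
  refine Finset.sum_congr rfl fun l _ => Finset.sum_congr rfl fun k _ => ?_
  ring

/-- The trace bound for the inverse flow controls $\mathrm{tr}(G(t)G(q)^{-1})$, and this trace
controls the ratio of determinants. -/
theorem det_le (h : MatrixFlow T ε G R) {q t : ℝ} (hq : 0 < q) (hqt : q ≤ t) (ht : t ≤ T) :
    (G t).det ≤ n.factorial * (n * (t / q) ^ (2 * ε)) ^ n * (G q).det := by
  have hqT : q ∈ Ioc 0 T := ⟨hq, hqt.trans ht⟩
  have htT : t ∈ Ioc 0 T := ⟨hq.trans_le hqt, ht⟩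
  have h1 := h.inv.1.trace_le hq hqt ht
  simp only [Matrix.nonsing_inv_nonsing_inv _ (h.isUnit_det htT)] at h1
  have h2 := det_le_of_trace (h.posDef t htT) (h.posDef q hqT).inv
  have hd := (h.posDef q hqT).det_pos
  rw [Matrix.det_nonsing_inv, Ring.inverse_eq_inv', ← div_eq_mul_inv, div_le_iff₀ hd] at h2
  refine h2.trans ?_
  have := trace_mul_nonneg (h.posDef t htT) (h.posDef q hqT).inv
  gcongr

end MatrixFlow

end Evolution

/-! ### Components in charts, and continuity of the curvature norm. -/

section Charts

open Matrix

theorem sum_smul_stdVec {n : ℕ} (v : EuclideanSpace ℝ (Fin n)) : ∑ i, v i • stdVec n i = v := by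
  ext j
  simp [stdVec, Pi.single_apply]

theorem bilin_eq_sum {n : ℕ}
    (b : EuclideanSpace ℝ (Fin n) →L[ℝ] EuclideanSpace ℝ (Fin n) →L[ℝ] ℝ)
    (v w : EuclideanSpace ℝ (Fin n)) :
    b v w = ∑ i, ∑ j, v i * w j * b (stdVec n i) (stdVec n j) := by
  conv_lhs => rw [← sum_smul_stdVec v, ← sum_smul_stdVec w]
  simp only [map_sum, map_smul, _root_.sum_apply, _root_.smul_apply,
    smul_eq_mul, Finset.mul_sum]
  refine Finset.sum_comm.trans (Finset.sum_congr rfl fun i _ => Finset.sum_congr rfl fun j _ => ?_)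
  ring

variable {n : ℕ} {Ω : Type*} [TopologicalSpace Ω] [ChartedSpace (EuclideanSpace ℝ (Fin n)) Ω]

theorem ext_coeff {g h : TwoTensor n Ω} {x : Ω} (e : coeff g x = coeff h x) : g x = h x := by
  have key (v w : EuclideanSpace ℝ (Fin n)) : g x v w = h x v w := by
    refine (bilin_eq_sum (g x) v w).trans (Eq.trans ?_ (bilin_eq_sum (h x) v w).symm)
    refine Finset.sum_congr rfl fun i _ => Finset.sum_congr rfl fun j _ => ?_
    have := congrFun (congrFun e i) j
    simp only [coeff, Matrix.of_apply] at this
    exact congrArg _ this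
  exact ContinuousLinearMap.ext fun v => ContinuousLinearMap.ext fun w => key v w

theorem posDef_coeff {g : TwoTensor n Ω} (hs : IsSymmetric g) (hp : IsPosDef g) (x : Ω) :
    (coeff g x).PosDef := by
  refine Matrix.PosDef.of_dotProduct_mulVec_pos ?_ fun {v} hv => ?_
  · ext i j
    exact hs x (stdVec n j) (stdVec n i)
  · have hv' : WithLp.toLp 2 v ≠ 0 := fun h => hv (by simpa using congrArg WithLp.ofLp h)
    have := hp x (WithLp.toLp 2 v) hv'
    refine this.trans_eq ((bilin_eq_sum (g x) _ _).trans ?_)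
    simp only [dotProduct, Matrix.mulVec, Finset.mul_sum, coeff, Matrix.of_apply]
    refine Finset.sum_congr rfl fun i _ => Finset.sum_congr rfl fun j _ => ?_
    simp only [Pi.star_apply, star_trivial]
    rw [mul_assoc, mul_comm (v j)]
    rfl

/-- The tensor with given components. -/
def ofCoeff (A : Ω → Matrix (Fin n) (Fin n) ℝ) : TwoTensor n Ω := fun x =>
  (∑ i, ∑ j, A x i j • (EuclideanSpace.proj i : EuclideanSpace ℝ (Fin n) →L[ℝ] ℝ).smulRight
    (EuclideanSpace.proj j : EuclideanSpace ℝ (Fin n) →L[ℝ] ℝ) :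
    EuclideanSpace ℝ (Fin n) →L[ℝ] EuclideanSpace ℝ (Fin n) →L[ℝ] ℝ)

theorem ofCoeff_apply (A : Ω → Matrix (Fin n) (Fin n) ℝ) (x : Ω)
    (v w : EuclideanSpace ℝ (Fin n)) :
    ofCoeff A x v w = ∑ i, ∑ j, A x i j * (v i * w j) := by
  have : ofCoeff A x v w = (∑ i, ∑ j, A x i j •
    (EuclideanSpace.proj i : EuclideanSpace ℝ (Fin n) →L[ℝ] ℝ).smulRight
    (EuclideanSpace.proj j : EuclideanSpace ℝ (Fin n) →L[ℝ] ℝ) :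
    EuclideanSpace ℝ (Fin n) →L[ℝ] EuclideanSpace ℝ (Fin n) →L[ℝ] ℝ) v w := rfl
  rw [this]
  simp only [_root_.sum_apply, _root_.smul_apply,
    ContinuousLinearMap.smulRight_apply, smul_eq_mul]
  rfl

theorem coeff_ofCoeff (A : Ω → Matrix (Fin n) (Fin n) ℝ) : coeff (ofCoeff A) = A := by
  funext x
  ext i j
  have := ofCoeff_apply A x (stdVec n i) (stdVec n j)
  simp only [coeff, Matrix.of_apply]
  refine this.trans ?_
  simp [stdVec, PiLp.single_apply]

theorem isSymmetric_ofCoeff {A : Ω → Matrix (Fin n) (Fin n) ℝ} (hA : ∀ x, (A x).PosDef) :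
    IsSymmetric (ofCoeff A) := by
  intro x v w
  refine (ofCoeff_apply A x v w).trans (Eq.trans ?_ (ofCoeff_apply A x w v).symm)
  rw [Finset.sum_comm]
  refine Finset.sum_congr rfl fun i _ => Finset.sum_congr rfl fun j _ => ?_
  have := (hA x).isHermitian.apply i j
  simp only [star_trivial] at this
  rw [this]
  ring

theorem isPosDef_ofCoeff {A : Ω → Matrix (Fin n) (Fin n) ℝ} (hA : ∀ x, (A x).PosDef) :
    IsPosDef (ofCoeff A) := by
  intro x v hv
  refine lt_of_lt_of_eq ?_ (ofCoeff_apply A x v v).symm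
  have hv' : (WithLp.ofLp (p := 2) v : Fin n → ℝ) ≠ 0 := fun h => hv (by
    exact congrArg (WithLp.toLp 2) h)
  have := (hA x).dotProduct_mulVec_pos hv'
  refine this.trans_eq ?_
  simp only [dotProduct, Matrix.mulVec, Finset.mul_sum]
  refine Finset.sum_congr rfl fun i _ => Finset.sum_congr rfl fun j _ => ?_
  simp only [Pi.star_apply, star_trivial]
  ring

theorem symm_mem_source {c : Ω} {y : EuclideanSpace ℝ (Fin n)}
    (hy : y ∈ (chartAt (EuclideanSpace ℝ (Fin n)) c).target) :
    (chartAt (EuclideanSpace ℝ (Fin n)) c).symm y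
      ∈ (chartAt (EuclideanSpace ℝ (Fin n)) c).source :=
  OpenPartialHomeomorph.map_target _ hy

theorem continuous_tnorm : Continuous fun z : Matrix (Fin n) (Fin n) ℝ × Matrix (Fin n) (Fin n) ℝ =>
    tnorm z.1 z.2 := by
  unfold tnorm
  refine Real.continuous_sqrt.comp ?_
  refine continuous_finsetSum _ fun i _ => continuous_finsetSum _ fun j _ =>
    continuous_finsetSum _ fun k _ => continuous_finsetSum _ fun m _ => ?_
  exact (((continuous_fst.matrix_elem i k).mul (continuous_fst.matrix_elem j m)).mul
    (continuous_snd.matrix_elem i j)).mul (continuous_snd.matrix_elem k m)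

variable [IsManifold (𝓡 n) ∞ Ω]

variable (n) in
/-- The Jacobian matrix at `z` of the transition map from `chartAt c` to `chartAt z`. -/
def jac (c z : Ω) : Matrix (Fin n) (Fin n) ℝ :=
  Matrix.of fun k i => tangentCoordChange (𝓡 n) c z z (stdVec n i) k

/-- The derivative of the transition map in the opposite direction is a left inverse. -/
theorem isUnit_det_jac {c z : Ω} (hz : z ∈ (chartAt (EuclideanSpace ℝ (Fin n)) c).source) :
    IsUnit (jac n c z).det := by
  rw [← Matrix.isUnit_iff_isUnit_det, ← Matrix.mulVec_injective_iff_isUnit]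
  have e (v : Fin n → ℝ) : jac n c z *ᵥ v
      = WithLp.ofLp (tangentCoordChange (𝓡 n) c z z (WithLp.toLp 2 v)) := by
    conv_rhs => rw [← sum_smul_stdVec (WithLp.toLp 2 v)]
    ext k
    simp [Matrix.mulVec, dotProduct, jac, mul_comm]
  intro v w hvw
  simp only [e] at hvw
  have h1 := congrArg (fun u => tangentCoordChange (𝓡 n) z c z (WithLp.toLp 2 u)) hvw
  have hz' : z ∈ (extChartAt (𝓡 n) c).source := by simpa using hz
  have hz2 : z ∈ (extChartAt (𝓡 n) z).source := mem_extChartAt_source z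
  simp only [WithLp.toLp_ofLp] at h1
  rw [tangentCoordChange_comp ⟨⟨hz', hz2⟩, hz'⟩, tangentCoordChange_comp ⟨⟨hz', hz2⟩, hz'⟩,
    tangentCoordChange_self hz', tangentCoordChange_self hz'] at h1
  simpa using h1

/-- Regularity is known in a fixed chart, whereas norms use a basis that varies with the point. This
congruence, combined with the invariance in `tnorm_congr_inv`, links the two. -/
theorem chartCoeff_eq (c : Ω) (g : TwoTensor n Ω) (y : EuclideanSpace ℝ (Fin n)) :
    chartCoeff c g y = (jac n c ((chartAt (EuclideanSpace ℝ (Fin n)) c).symm y))ᵀ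
      * coeff g ((chartAt (EuclideanSpace ℝ (Fin n)) c).symm y)
      * jac n c ((chartAt (EuclideanSpace ℝ (Fin n)) c).symm y) := by
  ext i j
  simp only [chartCoeff, Matrix.of_apply]
  refine (bilin_eq_sum (g _) _ _).trans ?_
  simp only [Matrix.mul_apply, Finset.sum_mul, coeff, jac, Matrix.of_apply, Matrix.transpose_apply]
  rw [Finset.sum_comm]
  exact Finset.sum_congr rfl fun k _ => Finset.sum_congr rfl fun l _ => mul_right_comm _ _ _

theorem chartCoeff_apply {c z : Ω} (hz : z ∈ (chartAt (EuclideanSpace ℝ (Fin n)) c).source)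
    (g : TwoTensor n Ω) :
    chartCoeff c g (chartAt (EuclideanSpace ℝ (Fin n)) c z) = (jac n c z)ᵀ * coeff g z * jac n c z := by
  rw [chartCoeff_eq, OpenPartialHomeomorph.left_inv _ hz]

theorem posDef_chartCoeff {g : TwoTensor n Ω} (hs : IsSymmetric g) (hp : IsPosDef g) {c : Ω}
    {y : EuclideanSpace ℝ (Fin n)} (hy : y ∈ (chartAt (EuclideanSpace ℝ (Fin n)) c).target) :
    (chartCoeff c g y).PosDef := by
  rw [chartCoeff_eq, ← Matrix.conjTranspose_eq_transpose_of_trivial]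
  refine (posDef_coeff hs hp _).conjTranspose_mul_mul_same ?_
  exact Matrix.mulVec_injective_iff_isUnit.2
    ((Matrix.isUnit_iff_isUnit_det _).2 (isUnit_det_jac (symm_mem_source hy)))

namespace IsRicciFlow

variable {T : ℝ} {ℓ : ℝ → TwoTensor n Ω}

theorem posDef_coeff (h : IsRicciFlow T ℓ) {t : ℝ} (ht : t ∈ Ioc 0 T) (x : Ω) :
    (coeff (ℓ t) x).PosDef := RFlow.posDef_coeff (h.symm t ht) (h.posDef t ht) x

/-- The time derivative of the components in a fixed chart. -/
theorem fderivWithin_chartCoeff (h : IsRicciFlow T ℓ) (c : Ω) {y : EuclideanSpace ℝ (Fin n)}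
    (hy : y ∈ (chartAt (EuclideanSpace ℝ (Fin n)) c).target) {t : ℝ} (ht : t ∈ Ioc 0 T)
    (i j : Fin n) :
    fderivWithin ℝ (fun q : EuclideanSpace ℝ (Fin n) × ℝ => chartCoeff c (ℓ q.2) q.1 i j)
      ((chartAt (EuclideanSpace ℝ (Fin n)) c).target ×ˢ Ioc 0 T) (y, t) (0, 1)
    = -2 * ((jac n c ((chartAt (EuclideanSpace ℝ (Fin n)) c).symm y))ᵀ
      * ricci (ℓ t) ((chartAt (EuclideanSpace ℝ (Fin n)) c).symm y)
      * jac n c ((chartAt (EuclideanSpace ℝ (Fin n)) c).symm y)) i j := by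
  set S := (chartAt (EuclideanSpace ℝ (Fin n)) c).target ×ˢ Ioc 0 T
  set z := (chartAt (EuclideanSpace ℝ (Fin n)) c).symm y with hz
  have h1 := ((h.smooth c i j).differentiableOn (by simp) (y, t) ⟨hy, ht⟩).hasFDerivWithinAt
  have h2 : HasDerivWithinAt (fun τ : ℝ => (y, τ)) ((0 : EuclideanSpace ℝ (Fin n)), (1 : ℝ))
      (Ioc 0 T) t := (hasDerivWithinAt_const _ _ _).prodMk (hasDerivWithinAt_id _ _)
  have h3 := h1.comp_hasDerivWithinAt (s := Ioc 0 T) t h2 (fun τ hτ => ⟨hy, hτ⟩)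
  have h4 : HasDerivWithinAt (fun τ => chartCoeff c (ℓ τ) y i j)
      (-2 * ((jac n c z)ᵀ * ricci (ℓ t) z * jac n c z) i j) (Ioc 0 T) t := by
    simp only [chartCoeff_eq, Matrix.mul_apply, Finset.sum_mul, Finset.mul_sum, ← hz]
    refine HasDerivWithinAt.fun_sum fun k _ => HasDerivWithinAt.fun_sum fun l _ => ?_
    have e : -2 * ((jac n c z)ᵀ i l * ricci (ℓ t) z l k * jac n c z k j)
        = (jac n c z)ᵀ i l * (-2 * ricci (ℓ t) z l k) * jac n c z k j := by ring
    rw [e]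
    exact ((h.flow t ht z l k).const_mul ((jac n c z)ᵀ i l)).mul_const (jac n c z k j)
  -- The same time derivative was computed twice; derivatives within the interval are unique also at
  -- the endpoint $t=T$.
  exact (uniqueDiffOn_Ioc 0 T t ht).eq_deriv _ h3 h4

/-- At each point `ricci` is computed in that point's own preferred chart, which need not vary
continuously. The flow equation avoids comparing Ricci tensors of different charts: in a fixed chart
the Ricci components are $-\tfrac12$ times the time derivative of the jointly smooth metric
components. -/
theorem continuousOn_covNorm_ricci (h : IsRicciFlow T ℓ) :
    ContinuousOn (fun z : Ω × ℝ => covNorm (ℓ z.2) (ricci (ℓ z.2)) z.1) (univ ×ˢ Ioc 0 T) := by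
  rintro ⟨x, t⟩ ⟨-, ht⟩
  set φ := chartAt (EuclideanSpace ℝ (Fin n)) x with hφ
  suffices hc : ContinuousOn (fun z : Ω × ℝ => covNorm (ℓ z.2) (ricci (ℓ z.2)) z.1)
      (φ.source ×ˢ Ioc 0 T) by
    have hx : x ∈ φ.source := mem_chart_source _ x
    refine (hc (x, t) ⟨hx, ht⟩).mono_of_mem_nhdsWithin ?_
    have : φ.source ×ˢ Ioc 0 T = (univ ×ˢ Ioc 0 T) ∩ (φ.source ×ˢ univ) := by
      ext z; simp [and_comm]
    rw [this]
    exact inter_mem_nhdsWithin _ ((φ.open_source.prod isOpen_univ).mem_nhds ⟨hx, mem_univ _⟩)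
  set S := φ.target ×ˢ Ioc 0 T
  have hu : UniqueDiffOn ℝ S := φ.open_target.uniqueDiffOn.prod (uniqueDiffOn_Ioc 0 T)
  have hG : ContinuousOn (fun z : EuclideanSpace ℝ (Fin n) × ℝ => chartCoeff x (ℓ z.2) z.1) S :=
    continuousOn_pi.2 fun i => continuousOn_pi.2 fun j => (h.smooth x i j).continuousOn
  have hGi : ContinuousOn (fun z : EuclideanSpace ℝ (Fin n) × ℝ =>
      (chartCoeff x (ℓ z.2) z.1)⁻¹) S := fun z hz =>
    continuousWithinAt_matrix_inv (hG z hz)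
      (posDef_chartCoeff (h.symm _ hz.2) (h.posDef _ hz.2) hz.1).det_pos.ne'
  have hD : ContinuousOn (fun z : EuclideanSpace ℝ (Fin n) × ℝ => (jac n x (φ.symm z.1))ᵀ
      * ricci (ℓ z.2) (φ.symm z.1) * jac n x (φ.symm z.1)) S := by
    refine continuousOn_pi.2 fun i => continuousOn_pi.2 fun j => ?_
    have h1 := ((h.smooth x i j).continuousOn_fderivWithin hu (by simp)).clm_apply
      (continuousOn_const (c := ((0 : EuclideanSpace ℝ (Fin n)), (1 : ℝ))))
    refine (h1.const_mul (-1 / 2 : ℝ)).congr fun z hz => ?_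
    have := h.fderivWithin_chartCoeff x hz.1 hz.2 i j
    simp only
    rw [this]
    ring
  have hN := continuous_tnorm.comp_continuousOn (hGi.prodMk hD)
  have hmap : ContinuousOn (fun z : Ω × ℝ => (φ z.1, z.2)) (φ.source ×ˢ Ioc 0 T) :=
    (φ.continuousOn.comp continuousOn_fst fun z hz => hz.1).prodMk continuousOn_snd
  refine (hN.comp hmap fun z hz => ⟨φ.map_source hz.1, hz.2⟩).congr fun z hz => ?_
  simp only [Function.comp]
  rw [φ.left_inv hz.1, chartCoeff_apply hz.1, tnorm_congr_inv (isUnit_det_jac hz.1)]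
  rfl

theorem matrixFlow (h : IsRicciFlow T ℓ) {ε : ℝ} (hε : 0 ≤ ε)
    (hb : ∀ t ∈ Ioc 0 T, ∀ x, covNorm (ℓ t) (ricci (ℓ t)) x ≤ ε / t) (x : Ω) :
    MatrixFlow T ε (fun q => coeff (ℓ q) x) (fun q => ricci (ℓ q) x) where
  eps_nonneg := hε
  posDef _ hq := h.posDef_coeff hq x
  deriv q hq i j := h.flow q hq x i j
  cont := h.continuousOn_covNorm_ricci.comp (f := fun q => (x, q))
    (continuousOn_const.prodMk continuousOn_id) fun _ hq => ⟨mem_univ _, hq⟩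
  bound q hq := hb q hq x

theorem isMeasurableTensor (h : IsRicciFlow T ℓ) {t : ℝ} (ht : t ∈ Ioc 0 T) :
    IsMeasurableTensor (ℓ t) := fun c i j =>
  ((h.smooth c i j).continuousOn.comp (f := fun y => (y, t))
    (continuousOn_id.prodMk continuousOn_const) fun _ hy => ⟨hy, ht⟩).aemeasurable
    (chartAt (EuclideanSpace ℝ (Fin n)) c).open_target.measurableSet

end IsRicciFlow

end Charts

/-! ### Comparison of Riemannian volumes and measurability. -/

section Volume

variable {n : ℕ} {Ω : Type*} [TopologicalSpace Ω] [ChartedSpace (EuclideanSpace ℝ (Fin n)) Ω]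
  [MeasurableSpace Ω] [BorelSpace Ω]

theorem aemeasurable_symm (c : Ω) : AEMeasurable (chartAt (EuclideanSpace ℝ (Fin n)) c).symm
    (volume.restrict (chartAt (EuclideanSpace ℝ (Fin n)) c).target) :=
  (chartAt (EuclideanSpace ℝ (Fin n)) c).continuousOn_symm.aemeasurable
    (chartAt (EuclideanSpace ℝ (Fin n)) c).open_target.measurableSet

variable [SecondCountableTopology Ω]

theorem countable_centres : (centres n Ω).Countable :=
  (exists_chart_partition n Ω).choose_spec.choose_spec.1

variable [IsManifold (𝓡 n) ∞ Ω]

/-- Needed to interchange the integrals over $\Omega$ and over time. -/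
instance sFinite_vol (g : TwoTensor n Ω) : SFinite (vol g) := by
  have : Countable (centres n Ω) := countable_centres.to_subtype
  unfold vol chartVol
  infer_instance

/-- At a given point of a chart both densities acquire the same Jacobian factor, so the pointwise
comparison of determinants passes to every chart and then to the countable sum. -/
theorem vol_le {g h : TwoTensor n Ω} {κ : ℝ} (hκ : 0 ≤ κ)
    (hgh : ∀ x, Real.sqrt (coeff g x).det ≤ κ * Real.sqrt (coeff h x).det) :
    vol g ≤ ENNReal.ofReal κ • vol h := by
  have hc (c : Ω) : chartVol g c ≤ ENNReal.ofReal κ • chartVol h c := by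
    unfold chartVol
    rw [← Measure.map_smul, ← withDensity_smul' _ _ ENNReal.ofReal_ne_top]
    refine Measure.map_mono_of_aemeasurable (withDensity_mono ?_)
      ((aemeasurable_symm c).mono_ac (withDensity_absolutelyContinuous _ _))
    refine (ae_restrict_mem
      (chartAt (EuclideanSpace ℝ (Fin n)) c).open_target.measurableSet).mono fun y hy => ?_
    rw [Pi.smul_apply, smul_eq_mul, ← ENNReal.ofReal_mul hκ]
    refine ENNReal.ofReal_le_ofReal ?_
    rw [chartCoeff_eq, chartCoeff_eq]
    simp only [Matrix.det_mul, Matrix.det_transpose]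
    set z := (chartAt (EuclideanSpace ℝ (Fin n)) c).symm y
    set d := (jac n c z).det
    have e (a : ℝ) : Real.sqrt (d * a * d) = |d| * Real.sqrt a := by
      rw [show d * a * d = d ^ 2 * a by ring, Real.sqrt_mul (sq_nonneg d), Real.sqrt_sq_eq_abs]
    rw [e, e, mul_left_comm]
    exact mul_le_mul_of_nonneg_left (hgh z) (abs_nonneg d)
  refine Measure.le_iff.2 fun s hs => ?_
  rw [vol, vol, Measure.smul_apply, Measure.sum_apply _ hs, Measure.sum_apply _ hs, smul_eq_mul,
    ← ENNReal.tsum_mul_left]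
  refine ENNReal.tsum_le_tsum fun c => ?_
  rw [← smul_eq_mul, ← Measure.smul_apply, ← Measure.restrict_smul]
  exact Measure.restrict_mono_measure (hc c) _ s

/-- A function which is measurable in every chart is measurable for the Riemannian volume. -/
theorem aemeasurable_vol {ψ : Ω → ℝ} (g : TwoTensor n Ω)
    (hψ : ∀ c : Ω, AEMeasurable (fun y => ψ ((chartAt (EuclideanSpace ℝ (Fin n)) c).symm y))
      (volume.restrict (chartAt (EuclideanSpace ℝ (Fin n)) c).target)) :
    AEMeasurable ψ (vol g) := by
  have : Countable (centres n Ω) := countable_centres.to_subtype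
  unfold vol
  refine aemeasurable_sum_measure_iff.2 fun c => AEMeasurable.restrict ?_
  set φ := chartAt (EuclideanSpace ℝ (Fin n)) (c : Ω) with hφ
  have hac := withDensity_absolutelyContinuous (volume.restrict φ.target)
    fun y => ENNReal.ofReal (Real.sqrt (chartCoeff (c : Ω) g y).det)
  set μ := (volume.restrict φ.target).withDensity
    fun y => ENNReal.ofReal (Real.sqrt (chartCoeff (c : Ω) g y).det) with hμ
  have hsymm : AEMeasurable φ.symm μ := (aemeasurable_symm (c : Ω)).mono_ac hac
  have hmem : ∀ᵐ y ∂μ, y ∈ φ.target :=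
    hac.ae_le (ae_restrict_mem φ.open_target.measurableSet)
  obtain ⟨k, hk, hkψ⟩ := (hψ c).mono_ac hac
  have hsrc : (chartVol g (c : Ω)) φ.sourceᶜ = 0 := by
    rw [chartVol, Measure.map_apply_of_aemeasurable hsymm φ.open_source.measurableSet.compl]
    exact measure_mono_null (fun y hy hy' => hy (φ.map_target hy')) hmem
  have hφm : AEMeasurable φ (chartVol g (c : Ω)) := by
    have := φ.continuousOn.aemeasurable (μ := chartVol g (c : Ω)) φ.open_source.measurableSet
    rwa [Measure.restrict_eq_self_of_ae_mem (s := φ.source)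
      (measure_eq_zero_iff_ae_notMem.1 hsrc |>.mono fun x hx => not_not.1 hx)] at this
  refine (hk.comp_aemeasurable hφm).congr ?_
  -- The chart pushes its volume forward to the weighted Lebesgue measure, so almost everywhere
  -- statements in coordinates pull back to $\Omega$.
  have hmap : (chartVol g (c : Ω)).map φ = μ := by
    rw [chartVol, AEMeasurable.map_map_of_aemeasurable hφm hsymm]
    refine (Measure.map_congr (hmem.mono fun y hy => ?_)).trans Measure.map_id
    exact φ.right_inv hy
  have hae : ∀ᵐ x ∂chartVol g (c : Ω), ψ (φ.symm (φ x)) = k (φ x) :=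
    ae_of_ae_map hφm (p := fun y => ψ (φ.symm y) = k y) (hmap ▸ hkψ)
  filter_upwards [hae, measure_eq_zero_iff_ae_notMem.1 hsrc] with x hx hx'
  rw [Function.comp, ← hx, φ.left_inv (not_not.1 hx')]

/-- By invariance the norm can be computed from chart components, where it is the square root of a
rational expression in measurable functions. -/
theorem aemeasurable_covNorm_sub {g : TwoTensor n Ω} (hg : IsMeasurableTensor g) {A B : TwoTensor n Ω} (hA : IsMeasurableTensor A)
    (hB : IsMeasurableTensor B) (h : TwoTensor n Ω) :
    AEMeasurable (covNorm g (coeff A - coeff B)) (vol h) := by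
  refine aemeasurable_vol h fun c => ?_
  set φ := chartAt (EuclideanSpace ℝ (Fin n)) (c : Ω) with hφ
  have hGm : AEMeasurable (fun y (i j : Fin n) => chartCoeff c g y i j) (volume.restrict φ.target) :=
    aemeasurable_pi_iff.2 fun i => aemeasurable_pi_iff.2 fun j => hg c i j
  have hinv (i j : Fin n) : AEMeasurable (fun y => (chartCoeff c g y)⁻¹ i j)
      (volume.restrict φ.target) := by
    have hd : Continuous fun M : Fin n → Fin n → ℝ => (Matrix.of M).det :=
      continuous_id.matrix_det
    have ha : Continuous fun M : Fin n → Fin n → ℝ => (Matrix.of M).adjugate i j :=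
      continuous_id.matrix_adjugate.matrix_elem i j
    simp only [Matrix.inv_def, Matrix.smul_apply, smul_eq_mul, Ring.inverse_eq_inv']
    exact (hd.measurable.comp_aemeasurable hGm).inv.mul (ha.measurable.comp_aemeasurable hGm)
  have hm : AEMeasurable (fun y => tnorm (chartCoeff c g y)⁻¹ (chartCoeff c A y - chartCoeff c B y))
      (volume.restrict φ.target) := by
    unfold tnorm
    refine Real.continuous_sqrt.measurable.comp_aemeasurable ?_
    refine Finset.aemeasurable_fun_sum _ fun i _ => Finset.aemeasurable_fun_sum _ fun j _ =>
      Finset.aemeasurable_fun_sum _ fun k _ => Finset.aemeasurable_fun_sum _ fun m _ => ?_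
    exact (((hinv i k).mul (hinv j m)).mul ((hA c i j).sub (hB c i j))).mul
      ((hA c k m).sub (hB c k m))
  refine hm.congr ((ae_restrict_mem φ.open_target.measurableSet).mono fun y hy => ?_)
  simp only [chartCoeff_eq, ← Matrix.sub_mul, ← Matrix.mul_sub]
  rw [tnorm_congr_inv (isUnit_det_jac (symm_mem_source hy))]
  rfl

end Volume

/-! ### Pointwise convergence at time zero. -/

section Convergence

open Matrix

variable {n : ℕ} {T ε : ℝ} {G R : ℝ → Matrix (Fin n) (Fin n) ℝ}

theorem ofReal_tnorm_add_rpow_le {H : Matrix (Fin n) (Fin n) ℝ} (hH : H.PosDef) {p : ℝ}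
    (hp : 2 ≤ p) (A B : Matrix (Fin n) (Fin n) ℝ) :
    ENNReal.ofReal (tnorm H (A + B) ^ p) ≤
      ENNReal.ofReal (2 ^ (p - 1)) * (ENNReal.ofReal (tnorm H A ^ p) +
        ENNReal.ofReal (tnorm H B ^ p)) := by
  have hp0 : 0 ≤ p := by linarith
  rw [← ENNReal.ofReal_rpow_of_nonneg (tnorm_nonneg _ _) hp0,
    ← ENNReal.ofReal_rpow_of_nonneg (tnorm_nonneg _ _) hp0,
    ← ENNReal.ofReal_rpow_of_nonneg (tnorm_nonneg _ _) hp0,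
    ← ENNReal.ofReal_rpow_of_pos (by norm_num), ENNReal.ofReal_ofNat]
  refine le_trans (ENNReal.rpow_le_rpow ?_ hp0)
    (ENNReal.rpow_add_le_mul_rpow_add_rpow _ _ (by linarith))
  rw [← ENNReal.ofReal_add (tnorm_nonneg _ _) (tnorm_nonneg _ _)]
  exact ENNReal.ofReal_le_ofReal (tnorm_add_le hH A B)

theorem exists_abs_apply_le_tnorm {H : Matrix (Fin n) (Fin n) ℝ} (hH : H.PosDef) :
    ∃ K, 0 < K ∧ ∀ (A : Matrix (Fin n) (Fin n) ℝ) (i j : Fin n), |A i j| ≤ K * tnorm H A := by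
  obtain ⟨Q, hQ, rfl⟩ := exists_eq_mul_transpose hH
  have hQ' : IsUnit Qᵀ.det := by simpa using hQ
  refine ⟨fro (Qᵀ)⁻¹ * fro Q⁻¹ + 1, by
    have := fro_nonneg (Qᵀ)⁻¹; have := fro_nonneg Q⁻¹; positivity, fun A i j => ?_⟩
  have hA : (Qᵀ)⁻¹ * (Qᵀ * A * Q) * Q⁻¹ = A := by
    rw [Matrix.mul_assoc Qᵀ, Matrix.nonsing_inv_mul_cancel_left _ _ hQ',
      Matrix.mul_nonsing_inv_cancel_right _ _ hQ]
  rw [tnorm_mul_transpose]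
  set B := Qᵀ * A * Q
  calc |A i j| ≤ fro A := abs_apply_le_fro A i j
    _ ≤ fro ((Qᵀ)⁻¹ * B) * fro Q⁻¹ := by rw [← hA]; exact fro_mul_le _ _
    _ ≤ fro (Qᵀ)⁻¹ * fro B * fro Q⁻¹ :=
        mul_le_mul_of_nonneg_right (fro_mul_le _ _) (fro_nonneg _)
    _ ≤ (fro (Qᵀ)⁻¹ * fro Q⁻¹ + 1) * fro B := by linarith [fro_nonneg B]

/-- The weighted time integral of `|R|_G` which controls the `p`-th power of the distance between
`G r` and `G s`. -/
def energy (ε p : ℝ) (G R : ℝ → Matrix (Fin n) (Fin n) ℝ) (t r s : ℝ) : ℝ≥0∞ :=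
  ∫⁻ q in Ioc r s, ENNReal.ofReal
    (2 * p * (n : ℝ) ^ p * ((t / q) ^ (2 * ε * p) * tnorm (G q)⁻¹ (R q)))

theorem energy_mono (ε p : ℝ) (G R : ℝ → Matrix (Fin n) (Fin n) ℝ) (t : ℝ) {r r' s s' : ℝ}
    (hr : r' ≤ r) (hs : s ≤ s') : energy ε p G R t r s ≤ energy ε p G R t r' s' :=
  lintegral_mono_set (Ioc_subset_Ioc hr hs)

namespace MatrixFlow

variable {p r s t : ℝ}

/-- In extended nonnegative reals the time integral also makes sense from time zero, where it may be
infinite at exceptional points. -/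
theorem ofReal_tnorm_sub_rpow_le (h : MatrixFlow T ε G R) (hp : 2 ≤ p) (hr : 0 < r)
    (hrs : r ≤ s) (hst : s ≤ t) (ht : t ≤ T) :
    ENNReal.ofReal (tnorm (G t)⁻¹ (G r - G s) ^ p) ≤ energy ε p G R t r s := by
  refine (ENNReal.ofReal_le_ofReal (h.tnorm_sub_rpow_le hp hr hrs hst ht)).trans_eq ?_
  have ht0 : 0 < t := (hr.trans_le hrs).trans_le hst
  have hc : ContinuousOn (fun q => 2 * p * (n : ℝ) ^ p * ((t / q) ^ (2 * ε * p)
      * tnorm (G q)⁻¹ (R q))) (Icc r s) :=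
    continuousOn_const.mul ((continuousOn_weight ht0 hr).mul
      (h.cont.mono fun q hq => ⟨hr.trans_le hq.1, (hq.2.trans hst).trans ht⟩))
  rw [intervalIntegral.integral_of_le hrs, energy]
  refine ofReal_integral_eq_lintegral_ofReal (hc.integrableOn_Icc.mono_set Ioc_subset_Icc_self) ?_
  refine (ae_restrict_mem measurableSet_Ioc).mono fun q hq => ?_
  have h1 : 0 ≤ (t / q) ^ (2 * ε * p) :=
    Real.rpow_nonneg (div_pos ht0 (hr.trans hq.1)).le _
  have h2 := tnorm_nonneg (G q)⁻¹ (R q)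
  have h3 : 0 ≤ p := by linarith
  simp only [Pi.zero_apply]
  positivity

theorem energy_inv (h : MatrixFlow T ε G R) (hr : 0 ≤ r) (hs : s ≤ T) :
    energy ε p (fun q => (G q)⁻¹) (fun q => -((G q)⁻¹ * R q * (G q)⁻¹)) t r s
      = energy ε p G R t r s := by
  refine setLIntegral_congr_fun measurableSet_Ioc fun q hq => ?_
  simp only
  rw [h.inv.2 q ⟨hr.trans_lt hq.1, hq.2.trans hs⟩]

theorem tendsto_energy (ht : 0 < t) (hfin : energy ε p G R t 0 t < ⊤) :
    Tendsto (fun s => energy ε p G R t 0 s) (𝓝[>] 0) (𝓝 0) := by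
  -- Absolute continuity of the integral is applied on the fixed interval up to `t`; the truncation
  -- is removed afterwards.
  have h1 : Tendsto (fun s => energy ε p G R t 0 (min s t)) (𝓝[>] 0) (𝓝 0) := by
    have hv : Tendsto (((volume : Measure ℝ).restrict (Ioc 0 t)) ∘ fun s => Ioc 0 s)
        (𝓝[>] 0) (𝓝 0) := by
      refine tendsto_of_tendsto_of_tendsto_of_le_of_le tendsto_const_nhds
        (h := fun s => ENNReal.ofReal s) ?_ (fun _ => zero_le) fun s => ?_
      · have := (ENNReal.continuous_ofReal.tendsto (0 : ℝ)).mono_left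
          (nhdsWithin_le_nhds (s := Ioi (0 : ℝ)))
        simpa using this
      · refine (Measure.restrict_apply_le _ _).trans_eq ?_
        simp
    have := tendsto_setLIntegral_zero hfin.ne hv
    refine this.congr fun s => ?_
    rw [Measure.restrict_restrict measurableSet_Ioc, Ioc_inter_Ioc, max_self]
    rfl
  refine h1.congr' ?_
  filter_upwards [Ioo_mem_nhdsGT ht] with s hs
  rw [min_eq_left hs.2.le]

/-- The energy between two small times is bounded by the energy from zero, which tends to zero, so
each entry is Cauchy. -/
theorem exists_tendsto (h : MatrixFlow T ε G R) (hp : 2 ≤ p) (ht : t ∈ Ioc 0 T)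
    (hfin : energy ε p G R t 0 t < ⊤) : ∃ L, Tendsto G (𝓝[>] 0) (𝓝 L) := by
  obtain ⟨K, hK, hKle⟩ := exists_abs_apply_le_tnorm (h.posDef t ht).inv
  have hent (i j : Fin n) : ∃ L, Tendsto (fun q => G q i j) (𝓝[>] 0) (𝓝 L) := by
    rw [← cauchy_map_iff_exists_tendsto, Metric.cauchy_iff]
    refine ⟨inferInstance, fun η hη => ?_⟩
    have hζ : (0 : ℝ≥0∞) < ENNReal.ofReal ((η / K) ^ p) := by
      rw [ENNReal.ofReal_pos]; positivity
    obtain ⟨s₀, hs₀, hs₀t⟩ := (((tendsto_energy ht.1 hfin).eventually_lt_const hζ).and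
      (Ioo_mem_nhdsGT ht.1)).exists
    have key {r s : ℝ} (hr : 0 < r) (hrs : r ≤ s) (hs : s ≤ s₀) :
        |G r i j - G s i j| < η := by
      have h1 := (h.ofReal_tnorm_sub_rpow_le hp hr hrs (hs.trans hs₀t.2.le) ht.2).trans_lt
        ((energy_mono ε p G R t hr.le hs).trans_lt hs₀)
      have h2 : tnorm (G t)⁻¹ (G r - G s) < η / K :=
        (Real.rpow_lt_rpow_iff (tnorm_nonneg _ _) (by positivity) (by linarith)).1
          (ENNReal.ofReal_lt_ofReal_iff_of_nonneg
            (Real.rpow_nonneg (tnorm_nonneg _ _) _) |>.1 h1)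
      calc |G r i j - G s i j| ≤ K * tnorm (G t)⁻¹ (G r - G s) := hKle (G r - G s) i j
        _ < η := by rwa [lt_div_iff₀' hK] at h2
    refine ⟨_, image_mem_map (Ioo_mem_nhdsGT hs₀t.1), ?_⟩
    rintro _ ⟨r, hr, rfl⟩ _ ⟨s, hs, rfl⟩
    rw [Real.dist_eq]
    rcases le_total r s with hrs | hrs
    · exact key hr.1 hrs hs.2.le
    · rw [abs_sub_comm]; exact key hs.1 hrs hr.2.le
  choose L hL using hent
  exact ⟨L, tendsto_pi_nhds.2 fun i => tendsto_pi_nhds.2 fun j => hL i j⟩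

/-- The estimate passes to the limit at time zero. -/
theorem ofReal_tnorm_sub_limit_rpow_le (h : MatrixFlow T ε G R) (hp : 2 ≤ p) (hs : 0 < s)
    (hst : s ≤ t) (ht : t ≤ T) {L : Matrix (Fin n) (Fin n) ℝ} (hL : Tendsto G (𝓝[>] 0) (𝓝 L)) :
    ENNReal.ofReal (tnorm (G t)⁻¹ (G s - L) ^ p) ≤ energy ε p G R t 0 s := by
  have h1 : Tendsto (fun r => ENNReal.ofReal (tnorm (G t)⁻¹ (G r - G s) ^ p)) (𝓝[>] 0)
      (𝓝 (ENNReal.ofReal (tnorm (G t)⁻¹ (L - G s) ^ p))) := by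
    have hc : Continuous fun M => ENNReal.ofReal (tnorm (G t)⁻¹ (M - G s) ^ p) :=
      ENNReal.continuous_ofReal.comp <| (continuous_tnorm.comp <|
        continuous_const.prodMk (continuous_id.sub continuous_const)).rpow_const
          fun _ => Or.inr (by linarith)
    exact (hc.tendsto L).comp hL
  rw [tnorm_sub_comm]
  refine le_of_tendsto h1 ?_
  filter_upwards [Ioo_mem_nhdsGT hs] with r hr
  exact (h.ofReal_tnorm_sub_rpow_le hp hr.1 hr.2.le hst ht).trans
    (energy_mono ε p G R t hr.1.le le_rfl)

end MatrixFlow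

/-- A limit of positive definite matrices whose inverses converge is positive definite. -/
theorem posDef_of_tendsto {ι : Type*} {l : Filter ι} [l.NeBot]
    {M : ι → Matrix (Fin n) (Fin n) ℝ} (hM : ∀ᶠ k in l, (M k).PosDef)
    {L N : Matrix (Fin n) (Fin n) ℝ} (hL : Tendsto M l (𝓝 L))
    (hN : Tendsto (fun k => (M k)⁻¹) l (𝓝 N)) : L.PosDef ∧ N = L⁻¹ := by
  -- Convergence of the inverses is what prevents degeneration: the limit is positive semidefinite
  -- and also invertible.
  have hLN : L * N = 1 := by
    refine tendsto_nhds_unique (hL.mul hN) (tendsto_const_nhds.congr' ?_)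
    filter_upwards [hM] with k hk
    exact (Matrix.mul_nonsing_inv _ hk.det_pos.ne'.isUnit).symm
  have hu : IsUnit L := IsUnit.of_mul_eq_one _ hLN
  have hherm : L.IsHermitian := by
    refine tendsto_nhds_unique (f := M) (l := l) ?_ hL
    refine ((continuous_id.matrix_conjTranspose.tendsto L).comp hL).congr' ?_
    filter_upwards [hM] with k hk
    exact hk.isHermitian
  have hpsd : L.PosSemidef := by
    refine Matrix.PosSemidef.of_dotProduct_mulVec_nonneg hherm fun v => ?_
    have hc : Continuous fun A : Matrix (Fin n) (Fin n) ℝ => star v ⬝ᵥ A *ᵥ v :=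
      continuous_const.dotProduct (continuous_id.matrix_mulVec continuous_const)
    refine ge_of_tendsto ((hc.tendsto L).comp hL) ?_
    filter_upwards [hM] with k hk
    exact hk.posSemidef.dotProduct_mulVec_nonneg v
  exact ⟨hpsd.posDef_iff_isUnit.2 hu, (Matrix.inv_eq_right_inv hLN).symm⟩

end Convergence

/-! ### Integral estimates over the manifold. -/

section Integration

variable {n : ℕ} {Ω : Type*} [TopologicalSpace Ω] [ChartedSpace (EuclideanSpace ℝ (Fin n)) Ω]
  [IsManifold (𝓡 n) ∞ Ω] [SecondCountableTopology Ω] [MeasurableSpace Ω] [BorelSpace Ω]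

/-- A Ricci flow whose Ricci curvature is small in `L¹` and, after scaling, in `L∞`. -/
structure IsSmallFlow (p T ε : ℝ) (ℓ : ℝ → TwoTensor n Ω) : Prop where
  two_le : 2 ≤ p
  flow : IsRicciFlow T ℓ
  eps_nonneg : 0 ≤ ε
  small : (2 * p + n) * ε ≤ 3 / 4
  int : ∀ t ∈ Ioc 0 T, ∫⁻ x, ENNReal.ofReal (covNorm (ℓ t) (ricci (ℓ t)) x) ∂(vol (ℓ t))
    ≤ ENNReal.ofReal ε
  bound : ∀ t ∈ Ioc 0 T, ∀ x, covNorm (ℓ t) (ricci (ℓ t)) x ≤ ε / t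

/-- The constant in the integral estimates. -/
def estConst (n : ℕ) (p : ℝ) : ℝ := 8 * p * (n : ℝ) ^ p * Real.sqrt (n.factorial * (n : ℝ) ^ n)

/-- The exponent $3/4$ is below $1$, so the weight is integrable down to time zero; the factor $4$
in `estConst` arises here. -/
theorem integral_weight {r s t : ℝ} (hr : 0 ≤ r) (hrs : r ≤ s) (ht : 0 < t) :
    ∫⁻ q in Ioc r s, ENNReal.ofReal ((t / q) ^ (3 / 4 : ℝ))
      = ENNReal.ofReal (4 * (t ^ (3 / 4 : ℝ) * (s ^ (1 / 4 : ℝ) - r ^ (1 / 4 : ℝ)))) := by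
  have h1 : IntervalIntegrable (fun q : ℝ => q ^ (-(3 / 4) : ℝ)) volume r s :=
    intervalIntegral.intervalIntegrable_rpow' (by norm_num)
  have h2 : ∫ q in r..s, t ^ (3 / 4 : ℝ) * q ^ (-(3 / 4) : ℝ)
      = 4 * (t ^ (3 / 4 : ℝ) * (s ^ (1 / 4 : ℝ) - r ^ (1 / 4 : ℝ))) := by
    rw [intervalIntegral.integral_const_mul, integral_rpow (Or.inl (by norm_num))]
    norm_num
    ring
  have hq {q : ℝ} (hq : q ∈ Ioc r s) :
      (t / q) ^ (3 / 4 : ℝ) = t ^ (3 / 4 : ℝ) * q ^ (-(3 / 4) : ℝ) := by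
    have hq0 : 0 < q := hr.trans_lt hq.1
    rw [Real.div_rpow ht.le hq0.le, Real.rpow_neg hq0.le, div_eq_mul_inv]
  rw [← h2, intervalIntegral.integral_of_le hrs, ofReal_integral_eq_lintegral_ofReal
    ((h1.const_mul _).1)]
  · exact setLIntegral_congr_fun measurableSet_Ioc fun q hq' => by rw [hq hq']
  · refine (ae_restrict_mem measurableSet_Ioc).mono fun q hq' => ?_
    simp only [Pi.zero_apply]
    rw [← hq hq']
    exact Real.rpow_nonneg (div_nonneg ht.le (hr.trans hq'.1.le)) _

namespace IsSmallFlow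

variable {p T ε : ℝ} {ℓ : ℝ → TwoTensor n Ω}

theorem matrixFlow (h : IsSmallFlow p T ε ℓ) (x : Ω) :
    MatrixFlow T ε (fun q => coeff (ℓ q) x) (fun q => ricci (ℓ q) x) :=
  h.flow.matrixFlow h.eps_nonneg h.bound x

/-- The density is the square root of the determinant, which turns the exponent $2n\varepsilon$ into
$n\varepsilon$. -/
theorem vol_le_smul (h : IsSmallFlow p T ε ℓ) {q t : ℝ} (hq : 0 < q) (hqt : q ≤ t) (ht : t ≤ T) :
    vol (ℓ t) ≤ ENNReal.ofReal (Real.sqrt (n.factorial * (n : ℝ) ^ n) * (t / q) ^ (n * ε))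
      • vol (ℓ q) := by
  have h0 : 0 < t / q := div_pos (hq.trans_le hqt) hq
  refine vol_le (by positivity) fun x => ?_
  have h1 := (h.matrixFlow x).det_le hq hqt ht
  have e : (n.factorial * (n * (t / q) ^ (2 * ε)) ^ n : ℝ)
      = n.factorial * (n : ℝ) ^ n * ((t / q) ^ (n * ε)) ^ 2 := by
    rw [mul_pow, ← mul_assoc, ← Real.rpow_natCast ((t / q) ^ (2 * ε)), ← Real.rpow_natCast
      ((t / q) ^ (n * ε)), ← Real.rpow_mul h0.le, ← Real.rpow_mul h0.le]
    congr 2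
    push_cast
    ring
  refine (Real.sqrt_le_sqrt h1).trans_eq ?_
  rw [e, Real.sqrt_mul (by positivity), Real.sqrt_mul (by positivity),
    Real.sqrt_sq (by positivity)]

theorem aemeasurable_kernel (h : IsSmallFlow p T ε ℓ) {r s t : ℝ} (hr : 0 ≤ r) (hsT : s ≤ T)
    (ht : 0 < t) :
    AEMeasurable (fun z : Ω × ℝ => ENNReal.ofReal (2 * p * (n : ℝ) ^ p *
      ((t / z.2) ^ (2 * ε * p) * tnorm (coeff (ℓ z.2) z.1)⁻¹ (ricci (ℓ z.2) z.1))))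
      ((vol (ℓ t)).prod (volume.restrict (Ioc r s))) := by
  have hsub : (univ : Set Ω) ×ˢ Ioc r s ⊆ univ ×ˢ Ioc 0 T :=
    prod_mono subset_rfl (Ioc_subset_Ioc hr hsT)
  rw [← Measure.restrict_univ (μ := vol (ℓ t)), Measure.prod_restrict]
  refine ENNReal.measurable_ofReal.comp_aemeasurable ?_
  refine ContinuousOn.aemeasurable ?_ (MeasurableSet.univ.prod measurableSet_Ioc)
  refine continuousOn_const.mul (ContinuousOn.mul ?_ (h.flow.continuousOn_covNorm_ricci.mono hsub))
  intro z hz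
  exact ((hasDerivAt_weight ht (hr.trans_lt hz.2.1)).continuousAt.comp
    (f := fun z : Ω × ℝ => z.2) continuousAt_snd).continuousWithinAt

theorem aemeasurable_energy (h : IsSmallFlow p T ε ℓ) {r s t : ℝ} (hr : 0 ≤ r) (hsT : s ≤ T)
    (ht : 0 < t) : AEMeasurable (fun x => energy ε p (fun q => coeff (ℓ q) x)
      (fun q => ricci (ℓ q) x) t r s) (vol (ℓ t)) :=
  (h.aemeasurable_kernel hr hsT ht).lintegral_prod_right'

/-- After exchanging the integrals, each slice is compared with the volume at its own time $q$,
where the $L^1$ curvature bound applies. The two weights together have exponent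
$(2p+n)\varepsilon\le3/4$. -/
theorem lintegral_energy_le (h : IsSmallFlow p T ε ℓ) {r s t : ℝ} (hr : 0 ≤ r) (hrs : r ≤ s)
    (hst : s ≤ t) (ht : t ∈ Ioc 0 T) :
    ∫⁻ x, energy ε p (fun q => coeff (ℓ q) x) (fun q => ricci (ℓ q) x) t r s ∂(vol (ℓ t))
      ≤ ENNReal.ofReal (estConst n p * ε * (t ^ (3 / 4 : ℝ) * (s ^ (1 / 4 : ℝ) - r ^ (1 / 4 : ℝ)))) := by
  have hp : 0 ≤ p := by linarith [h.two_le]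
  set κ := Real.sqrt (n.factorial * (n : ℝ) ^ n)
  have hκ : 0 ≤ κ := Real.sqrt_nonneg _
  unfold energy
  rw [lintegral_lintegral_swap (h.aemeasurable_kernel hr (hst.trans ht.2) ht.1)]
  have key : ∀ q ∈ Ioc r s, ∫⁻ x, ENNReal.ofReal (2 * p * (n : ℝ) ^ p *
      ((t / q) ^ (2 * ε * p) * tnorm (coeff (ℓ q) x)⁻¹ (ricci (ℓ q) x))) ∂(vol (ℓ t))
      ≤ ENNReal.ofReal (2 * p * (n : ℝ) ^ p * κ * ε) * ENNReal.ofReal ((t / q) ^ (3 / 4 : ℝ)) := by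
    intro q hq
    have hq0 : 0 < q := hr.trans_lt hq.1
    have hqt : q ≤ t := hq.2.trans hst
    have h0 : 0 < t / q := div_pos ht.1 hq0
    have h1 : 1 ≤ t / q := (one_le_div hq0).2 hqt
    have hw : (t / q) ^ (2 * ε * p) * (t / q) ^ (n * ε) ≤ (t / q) ^ (3 / 4 : ℝ) := by
      rw [← Real.rpow_add h0]
      exact Real.rpow_le_rpow_of_exponent_le h1 (by linarith [h.small])
    calc ∫⁻ x, ENNReal.ofReal (2 * p * (n : ℝ) ^ p *
          ((t / q) ^ (2 * ε * p) * tnorm (coeff (ℓ q) x)⁻¹ (ricci (ℓ q) x))) ∂(vol (ℓ t))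
        = ENNReal.ofReal (2 * p * (n : ℝ) ^ p * (t / q) ^ (2 * ε * p)) *
          ∫⁻ x, ENNReal.ofReal (covNorm (ℓ q) (ricci (ℓ q)) x) ∂(vol (ℓ t)) := by
          rw [← lintegral_const_mul' _ _ ENNReal.ofReal_ne_top]
          refine lintegral_congr fun x => ?_
          rw [← ENNReal.ofReal_mul (by positivity), mul_assoc (2 * p * (n : ℝ) ^ p)]
          rfl
      _ ≤ ENNReal.ofReal (2 * p * (n : ℝ) ^ p * (t / q) ^ (2 * ε * p)) *
          (ENNReal.ofReal (κ * (t / q) ^ (n * ε)) * ENNReal.ofReal ε) := by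
          gcongr
          refine (lintegral_mono' (h.vol_le_smul hq0 hqt ht.2) le_rfl).trans ?_
          rw [lintegral_smul_measure, smul_eq_mul]
          gcongr
          exact h.int q ⟨hq0, hqt.trans ht.2⟩
      _ ≤ _ := by
          have := h.eps_nonneg
          rw [← ENNReal.ofReal_mul (by positivity), ← ENNReal.ofReal_mul (by positivity),
            ← ENNReal.ofReal_mul (by positivity)]
          refine ENNReal.ofReal_le_ofReal ?_
          calc _ = 2 * p * (n : ℝ) ^ p * κ * ε * ((t / q) ^ (2 * ε * p) * (t / q) ^ (n * ε)) := by
                ring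
            _ ≤ _ := by gcongr
  refine (setLIntegral_mono' measurableSet_Ioc key).trans_eq ?_
  have := h.eps_nonneg
  rw [lintegral_const_mul' _ _ ENNReal.ofReal_ne_top, integral_weight hr hrs ht.1,
    ← ENNReal.ofReal_mul (by positivity)]
  congr 1
  simp only [estConst]
  ring

/-- The basic estimate for the distance between two times, for the metrics and the inverses. -/
theorem lintegral_sub_le (h : IsSmallFlow p T ε ℓ) {r s t : ℝ} (hr : 0 < r) (hrs : r ≤ s)
    (hst : s ≤ t) (ht : t ∈ Ioc 0 T) :
    ∫⁻ x, ENNReal.ofReal (covNorm (ℓ t) (coeff (ℓ r) - coeff (ℓ s)) x ^ p) ∂(vol (ℓ t))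
      ≤ ENNReal.ofReal (estConst n p * ε * (t ^ (3 / 4 : ℝ) * (s ^ (1 / 4 : ℝ) - r ^ (1 / 4 : ℝ)))) ∧
    ∫⁻ x, ENNReal.ofReal (contraNorm (ℓ t) (coeffInv (ℓ r) - coeffInv (ℓ s)) x ^ p) ∂(vol (ℓ t))
      ≤ ENNReal.ofReal
        (estConst n p * ε * (t ^ (3 / 4 : ℝ) * (s ^ (1 / 4 : ℝ) - r ^ (1 / 4 : ℝ)))) := by
  constructor
  · refine le_trans (lintegral_mono fun x => ?_) (h.lintegral_energy_le hr.le hrs hst ht)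
    exact (h.matrixFlow x).ofReal_tnorm_sub_rpow_le h.two_le hr hrs hst ht.2
  · refine le_trans (lintegral_mono fun x => ?_) (h.lintegral_energy_le hr.le hrs hst ht)
    have h1 := (h.matrixFlow x).inv.1.ofReal_tnorm_sub_rpow_le h.two_le hr hrs hst ht.2
    rw [(h.matrixFlow x).energy_inv hr.le (hst.trans ht.2),
      Matrix.nonsing_inv_nonsing_inv _ ((h.matrixFlow x).isUnit_det ht)] at h1
    exact h1

theorem contraNorm_self (h : IsSmallFlow p T ε ℓ) {t : ℝ} (ht : t ∈ Ioc 0 T) (x : Ω) :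
    contraNorm (ℓ t) (coeffInv (ℓ t)) x = Real.sqrt n := by
  have h1 := tnorm_inv_self (h.flow.posDef_coeff ht x).inv
  rw [Matrix.nonsing_inv_nonsing_inv _ ((h.matrixFlow x).isUnit_det ht)] at h1
  exact h1

/-- A bound for the `L^p` norm of a tensor on `A` by its distance to the metric. -/
theorem setLIntegral_covNorm_le (h : IsSmallFlow p T ε ℓ) {t : ℝ} (ht : t ∈ Ioc 0 T) (A : Set Ω)
    (B : Ω → Matrix (Fin n) (Fin n) ℝ) :
    ∫⁻ x in A, ENNReal.ofReal (covNorm (ℓ t) B x ^ p) ∂(vol (ℓ t)) ≤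
      ENNReal.ofReal (2 ^ (p - 1)) * (ENNReal.ofReal (Real.sqrt n ^ p) * vol (ℓ t) A +
        ∫⁻ x, ENNReal.ofReal (covNorm (ℓ t) (coeff (ℓ t) - B) x ^ p) ∂(vol (ℓ t))) := by
  refine (lintegral_mono fun x => ?_).trans ((lintegral_const_mul' _ _ ENNReal.ofReal_ne_top).trans_le
    (mul_le_mul_right (?_ : ∫⁻ x in A, (ENNReal.ofReal (Real.sqrt n ^ p) + ENNReal.ofReal
      (covNorm (ℓ t) (coeff (ℓ t) - B) x ^ p)) ∂(vol (ℓ t)) ≤ _) _))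
  · have h1 := ofReal_tnorm_add_rpow_le (h.flow.posDef_coeff ht x).inv h.two_le
      (coeff (ℓ t) x) (B x - coeff (ℓ t) x)
    rw [add_sub_cancel, tnorm_sub_comm, tnorm_inv_self (h.flow.posDef_coeff ht x)] at h1
    exact h1
  · rw [lintegral_add_left measurable_const, setLIntegral_const]
    gcongr
    exact Measure.restrict_le_self

theorem setLIntegral_contraNorm_le (h : IsSmallFlow p T ε ℓ) {t : ℝ} (ht : t ∈ Ioc 0 T)
    (A : Set Ω) (B : Ω → Matrix (Fin n) (Fin n) ℝ) :
    ∫⁻ x in A, ENNReal.ofReal (contraNorm (ℓ t) B x ^ p) ∂(vol (ℓ t)) ≤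
      ENNReal.ofReal (2 ^ (p - 1)) * (ENNReal.ofReal (Real.sqrt n ^ p) * vol (ℓ t) A +
        ∫⁻ x, ENNReal.ofReal (contraNorm (ℓ t) (coeffInv (ℓ t) - B) x ^ p) ∂(vol (ℓ t))) := by
  refine (lintegral_mono fun x => ?_).trans ((lintegral_const_mul' _ _ ENNReal.ofReal_ne_top).trans_le
    (mul_le_mul_right (?_ : ∫⁻ x in A, (ENNReal.ofReal (Real.sqrt n ^ p) + ENNReal.ofReal
      (contraNorm (ℓ t) (coeffInv (ℓ t) - B) x ^ p)) ∂(vol (ℓ t)) ≤ _) _))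
  · have h1 := ofReal_tnorm_add_rpow_le (h.flow.posDef_coeff ht x) h.two_le
      (coeffInv (ℓ t) x) (B x - coeffInv (ℓ t) x)
    rw [add_sub_cancel, tnorm_sub_comm, show tnorm (coeff (ℓ t) x) (coeffInv (ℓ t) x) = Real.sqrt n
      from h.contraNorm_self ht x] at h1
    exact h1
  · rw [lintegral_add_left measurable_const, setLIntegral_const]
    gcongr
    exact Measure.restrict_le_self

end IsSmallFlow

end Integration

/-! ### The initial tensor: construction, measurability, convergence, uniqueness. -/

section InitialTensor

variable {n : ℕ} {Ω : Type*} [TopologicalSpace Ω] [ChartedSpace (EuclideanSpace ℝ (Fin n)) Ω]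

/-- Along the times `T / (k + 1)` the metrics and their inverses converge at `x`. -/
def Converges (T : ℝ) (ℓ : ℝ → TwoTensor n Ω) (x : Ω) : Prop :=
  (∃ L, Tendsto (fun k : ℕ => coeff (ℓ (T / (k + 1))) x) atTop (𝓝 L)) ∧
    ∃ N, Tendsto (fun k : ℕ => coeffInv (ℓ (T / (k + 1))) x) atTop (𝓝 N)

open Classical in
/-- The components of the limit of the metrics at time zero, where it exists. -/
def initialCoeff (T : ℝ) (ℓ : ℝ → TwoTensor n Ω) (x : Ω) : Matrix (Fin n) (Fin n) ℝ :=
  -- The default $\ell(T)$ keeps the tensor positive definite at every point, also on the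
  -- exceptional null set.
  if h : Converges T ℓ x then h.1.choose else coeff (ℓ T) x

/-- The limit of the metrics at time zero. -/
def initialTensor (T : ℝ) (ℓ : ℝ → TwoTensor n Ω) : TwoTensor n Ω := ofCoeff (initialCoeff T ℓ)

theorem tendsto_initialCoeff {T : ℝ} {ℓ : ℝ → TwoTensor n Ω} {x : Ω} (h : Converges T ℓ x) :
    Tendsto (fun k : ℕ => coeff (ℓ (T / (k + 1))) x) atTop (𝓝 (initialCoeff T ℓ x)) := by
  rw [initialCoeff, dif_pos h]
  exact h.1.choose_spec

theorem div_succ_mem_Ioc {T : ℝ} (hT : 0 < T) (k : ℕ) : T / (k + 1) ∈ Ioc 0 T :=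
  ⟨by positivity, div_le_self hT.le (by linarith [(k.cast_nonneg : (0 : ℝ) ≤ k)])⟩

theorem tendsto_div_succ {T : ℝ} (hT : 0 < T) :
    Tendsto (fun k : ℕ => T / (k + 1)) atTop (𝓝[>] (0 : ℝ)) := by
  refine tendsto_nhdsWithin_iff.2 ⟨?_, Eventually.of_forall fun k => (div_succ_mem_Ioc hT k).1⟩
  have := (tendsto_one_div_add_atTop_nhds_zero_nat (𝕜 := ℝ)).const_mul T
  simpa [div_eq_mul_inv] using this

theorem tendsto_conj {ι : Type*} {l : Filter ι} {M : ι → Matrix (Fin n) (Fin n) ℝ}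
    {L : Matrix (Fin n) (Fin n) ℝ} (h : Tendsto M l (𝓝 L)) (P Q : Matrix (Fin n) (Fin n) ℝ) :
    Tendsto (fun k => P * M k * Q) l (𝓝 (P * L * Q)) :=
  (tendsto_const_nhds.mul h).mul tendsto_const_nhds

/-- This is why the limit is defined along a sequence of times: the convergence set of countably
many measurable functions is measurable. -/
theorem measurableSet_exists_tendsto_matrix {X : Type*} [MeasurableSpace X]
    {f : ℕ → X → Matrix (Fin n) (Fin n) ℝ} (hf : ∀ k i j, Measurable fun y => f k y i j) :
    MeasurableSet {y | ∃ L, Tendsto (fun k => f k y) atTop (𝓝 L)} :=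
  measurableSet_exists_tendsto (γ := Fin n → Fin n → ℝ) (f := f) fun k =>
    measurable_pi_iff.2 fun i => measurable_pi_iff.2 fun j => hf k i j

theorem tendsto_lintegral_of_le {t K : ℝ} (ht : 0 < t) {f : ℝ → ℝ≥0∞}
    (hf : ∀ s, 0 < s → s ≤ t → f s ≤ ENNReal.ofReal (K * (t ^ (3 / 4 : ℝ) * s ^ (1 / 4 : ℝ)))) :
    Tendsto f (𝓝[>] 0) (𝓝 0) := by
  have hc : Continuous fun s : ℝ => ENNReal.ofReal (K * (t ^ (3 / 4 : ℝ) * s ^ (1 / 4 : ℝ))) :=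
    ENNReal.continuous_ofReal.comp (continuous_const.mul (continuous_const.mul
      (Real.continuous_rpow_const (by norm_num))))
  have h0 := (hc.tendsto 0).mono_left (nhdsWithin_le_nhds (s := Ioi (0 : ℝ)))
  rw [Real.zero_rpow (by norm_num), mul_zero, mul_zero, ENNReal.ofReal_zero] at h0
  refine tendsto_of_tendsto_of_tendsto_of_le_of_le' tendsto_const_nhds h0
    (Eventually.of_forall fun _ => zero_le) ?_
  filter_upwards [Ioo_mem_nhdsGT ht] with s hs
  exact hf s hs.1 hs.2.le

variable [IsManifold (𝓡 n) ∞ Ω]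

theorem posDef_initialCoeff {T : ℝ} {ℓ : ℝ → TwoTensor n Ω} (h : IsRicciFlow T ℓ) (hT : 0 < T)
    (x : Ω) : (initialCoeff T ℓ x).PosDef := by
  by_cases hx : Converges T ℓ x
  · exact (posDef_of_tendsto (Eventually.of_forall fun k =>
      h.posDef_coeff (div_succ_mem_Ioc hT k) x) (tendsto_initialCoeff hx) hx.2.choose_spec).1
  · rw [initialCoeff, dif_neg hx]
    exact h.posDef_coeff ⟨hT, le_rfl⟩ x

/-- At a fixed point the two bases differ by a fixed invertible congruence, which preserves
convergence in both directions. -/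
theorem converges_iff_chart {T : ℝ} {ℓ : ℝ → TwoTensor n Ω} {c : Ω}
    {y : EuclideanSpace ℝ (Fin n)} (hy : y ∈ (chartAt (EuclideanSpace ℝ (Fin n)) c).target) :
    Converges T ℓ ((chartAt (EuclideanSpace ℝ (Fin n)) c).symm y) ↔
      (∃ L, Tendsto (fun k : ℕ => chartCoeff c (ℓ (T / (k + 1))) y) atTop (𝓝 L)) ∧
        ∃ N, Tendsto (fun k : ℕ => (chartCoeff c (ℓ (T / (k + 1))) y)⁻¹) atTop (𝓝 N) := by
  have hP := isUnit_det_jac (symm_mem_source hy)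
  have e1 (g : TwoTensor n Ω) := chartCoeff_eq c g y
  simp only [Converges, coeffInv, e1]
  set z := (chartAt (EuclideanSpace ℝ (Fin n)) c).symm y
  set P := jac n c z
  have hP' : IsUnit P.transpose.det := by simpa using hP
  have e2 (M : Matrix (Fin n) (Fin n) ℝ) :
      (P.transpose * M * P)⁻¹ = P⁻¹ * M⁻¹ * P.transpose⁻¹ := by
    rw [Matrix.mul_inv_rev, Matrix.mul_inv_rev, Matrix.mul_assoc]
  have e3 (M : Matrix (Fin n) (Fin n) ℝ) :
      P.transpose⁻¹ * (P.transpose * M * P) * P⁻¹ = M := by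
    rw [Matrix.mul_assoc P.transpose, Matrix.nonsing_inv_mul_cancel_left _ _ hP',
      Matrix.mul_nonsing_inv_cancel_right _ _ hP]
  have e4 (M : Matrix (Fin n) (Fin n) ℝ) :
      P * (P⁻¹ * M * P.transpose⁻¹) * P.transpose = M := by
    rw [Matrix.mul_assoc P⁻¹, Matrix.mul_nonsing_inv_cancel_left _ _ hP,
      Matrix.nonsing_inv_mul_cancel_right _ _ hP']
  simp only [e2]
  constructor
  · rintro ⟨⟨L, hL⟩, N, hN⟩
    exact ⟨⟨_, tendsto_conj hL _ _⟩, _, tendsto_conj hN _ _⟩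
  · rintro ⟨⟨L, hL⟩, N, hN⟩
    refine ⟨⟨_, (tendsto_conj hL P.transpose⁻¹ P⁻¹).congr fun k => e3 _⟩,
      _, (tendsto_conj hN P P.transpose).congr fun k => e4 _⟩

theorem isMeasurableTensor_initialTensor {T : ℝ} {ℓ : ℝ → TwoTensor n Ω} (h : IsRicciFlow T ℓ)
    (hT : 0 < T) : IsMeasurableTensor (initialTensor T ℓ) := by
  classical
  intro c i j
  set φ := chartAt (EuclideanSpace ℝ (Fin n)) c with hφ
  have hU : MeasurableSet φ.target := φ.open_target.measurableSet
  have hG {t : ℝ} (ht : t ∈ Ioc 0 T) : ContinuousOn (fun y => chartCoeff c (ℓ t) y) φ.target :=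
    continuousOn_pi.2 fun i => continuousOn_pi.2 fun j => (h.smooth c i j).continuousOn.comp
      (f := fun y => (y, t)) (continuousOn_id.prodMk continuousOn_const) fun _ hy => ⟨hy, ht⟩
  have hGi {t : ℝ} (ht : t ∈ Ioc 0 T) : ContinuousOn (fun y => (chartCoeff c (ℓ t) y)⁻¹) φ.target :=
    fun y hy => continuousWithinAt_matrix_inv (hG ht y hy)
      (posDef_chartCoeff (h.symm _ ht) (h.posDef _ ht) hy).det_pos.ne'
  -- Extension by zero outside the chart target gives globally measurable functions.
  have hind {F : EuclideanSpace ℝ (Fin n) → Matrix (Fin n) (Fin n) ℝ} (hF : ContinuousOn F φ.target)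
      (i j : Fin n) : Measurable fun y => (if y ∈ φ.target then F y else 0) i j := by
    have h1 : ContinuousOn (fun y => F y i j) φ.target :=
      (continuous_apply_apply i j).comp_continuousOn hF
    have h2 : Measurable (φ.target.piecewise (fun y => F y i j) (fun _ => 0)) :=
      h1.measurable_piecewise continuousOn_const hU
    convert h2 using 2 with y
    by_cases hy : y ∈ φ.target <;> simp [hy, Set.piecewise]
  set E : Set (EuclideanSpace ℝ (Fin n)) := {y | ∃ L, Tendsto (fun k : ℕ =>
      if y ∈ φ.target then chartCoeff c (ℓ (T / (k + 1))) y else 0) atTop (𝓝 L)} ∩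
    {y | ∃ N, Tendsto (fun k : ℕ =>
      if y ∈ φ.target then (chartCoeff c (ℓ (T / (k + 1))) y)⁻¹ else 0) atTop (𝓝 N)} with hE
  have hEm : MeasurableSet E :=
    (measurableSet_exists_tendsto_matrix fun k => hind (hG (div_succ_mem_Ioc hT k))).inter
      (measurableSet_exists_tendsto_matrix fun k => hind (hGi (div_succ_mem_Ioc hT k)))
  have hEiff {y : EuclideanSpace ℝ (Fin n)} (hy : y ∈ φ.target) :
      y ∈ E ↔ Converges T ℓ (φ.symm y) := by
    rw [converges_iff_chart hy, hE]
    simp only [mem_inter_iff, mem_ofPred_eq, if_pos hy]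
  -- The approximants are the metrics along the sequence on `E`, and the default $\ell(T)$ off it.
  refine aemeasurable_of_tendsto_metrizable_ae (atTop : Filter ℕ)
    (f := fun (k : ℕ) y => E.piecewise (fun y => chartCoeff c (ℓ (T / (k + 1))) y i j)
      (fun y => chartCoeff c (ℓ T) y i j) y) (fun k => ?_) ?_
  · rw [← Set.indicator_add_compl_eq_piecewise]
    exact ((h.isMeasurableTensor (div_succ_mem_Ioc hT k) c i j).indicator hEm).add
      ((h.isMeasurableTensor ⟨hT, le_rfl⟩ c i j).indicator hEm.compl)
  · refine (ae_restrict_mem hU).mono fun y hy => ?_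
    have hlim : chartCoeff c (initialTensor T ℓ) y = (jac n c (φ.symm y)).transpose
        * initialCoeff T ℓ (φ.symm y) * jac n c (φ.symm y) := by
      rw [chartCoeff_eq, initialTensor, coeff_ofCoeff]
    by_cases hyE : y ∈ E
    · simp only [Set.piecewise_eq_of_mem _ _ _ hyE, hlim]
      have h1 := tendsto_conj (tendsto_initialCoeff ((hEiff hy).1 hyE))
        (jac n c (φ.symm y)).transpose (jac n c (φ.symm y))
      refine ((continuous_apply_apply i j).continuousAt.tendsto.comp h1).congr fun k => ?_
      simp only [Function.comp]
      rw [chartCoeff_eq]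
    · simp only [Set.piecewise_eq_of_notMem _ _ _ hyE]
      rw [hlim, initialCoeff, dif_neg (fun hc => hyE ((hEiff hy).2 hc)), chartCoeff_eq]
      exact tendsto_const_nhds

variable [SecondCountableTopology Ω] [MeasurableSpace Ω] [BorelSpace Ω]

namespace IsSmallFlow

variable {p T ε : ℝ} {ℓ : ℝ → TwoTensor n Ω}

/-- The energy from time zero has finite integral, so it is finite almost everywhere. The inverse
flow has the same energy, so both limits exist at the same points. -/
theorem ae_tendsto (h : IsSmallFlow p T ε ℓ) {t : ℝ} (ht : t ∈ Ioc 0 T) :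
    ∀ᵐ x ∂(vol (ℓ t)),
      Tendsto (fun s => coeff (ℓ s) x) (𝓝[>] 0) (𝓝 (coeff (initialTensor T ℓ) x)) ∧
      Tendsto (fun s => coeffInv (ℓ s) x) (𝓝[>] 0) (𝓝 (coeffInv (initialTensor T ℓ) x)) := by
  have hT : 0 < T := ht.1.trans_le ht.2
  have hfin := ae_lt_top' (h.aemeasurable_energy le_rfl ht.2 ht.1)
    ((h.lintegral_energy_le le_rfl ht.1.le le_rfl ht).trans_lt ENNReal.ofReal_lt_top).ne
  filter_upwards [hfin] with x hx
  obtain ⟨L, hL⟩ := (h.matrixFlow x).exists_tendsto h.two_le ht hx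
  rw [← (h.matrixFlow x).energy_inv le_rfl ht.2] at hx
  obtain ⟨N, hN⟩ := (h.matrixFlow x).inv.1.exists_tendsto h.two_le ht hx
  have hc : Converges T ℓ x :=
    ⟨⟨L, hL.comp (tendsto_div_succ hT)⟩, N, hN.comp (tendsto_div_succ hT)⟩
  have hLe : initialCoeff T ℓ x = L :=
    tendsto_nhds_unique (tendsto_initialCoeff hc) (hL.comp (tendsto_div_succ hT))
  have hNe : N = L⁻¹ := by
    refine (posDef_of_tendsto ?_ hL hN).2
    filter_upwards [Ioo_mem_nhdsGT hT] with s hs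
    exact h.flow.posDef_coeff (Ioo_subset_Ioc_self hs) x
  rw [coeffInv, initialTensor, coeff_ofCoeff, hLe, ← hNe]
  exact ⟨hL, hN⟩

/-- The pointwise estimate already holds for the limit at almost every point, so only the energy
from time zero has to be integrated. -/
theorem lintegral_sub_initial_le (h : IsSmallFlow p T ε ℓ) {s t : ℝ} (hs : 0 < s) (hst : s ≤ t)
    (ht : t ∈ Ioc 0 T) :
    ∫⁻ x, ENNReal.ofReal (covNorm (ℓ t) (coeff (ℓ s) - coeff (initialTensor T ℓ)) x ^ p)
        ∂(vol (ℓ t))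
      ≤ ENNReal.ofReal (estConst n p * ε * (t ^ (3 / 4 : ℝ) * s ^ (1 / 4 : ℝ))) ∧
    ∫⁻ x, ENNReal.ofReal (contraNorm (ℓ t) (coeffInv (ℓ s) - coeffInv (initialTensor T ℓ)) x ^ p)
        ∂(vol (ℓ t))
      ≤ ENNReal.ofReal (estConst n p * ε * (t ^ (3 / 4 : ℝ) * s ^ (1 / 4 : ℝ))) := by
  have hE := h.lintegral_energy_le le_rfl hs.le hst ht
  rw [Real.zero_rpow (by norm_num), sub_zero] at hE
  constructor
  · refine le_trans (lintegral_mono_ae ?_) hE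
    filter_upwards [h.ae_tendsto ht] with x hx
    exact (h.matrixFlow x).ofReal_tnorm_sub_limit_rpow_le h.two_le hs hst ht.2 hx.1
  · refine le_trans (lintegral_mono_ae ?_) hE
    filter_upwards [h.ae_tendsto ht] with x hx
    have h1 := (h.matrixFlow x).inv.1.ofReal_tnorm_sub_limit_rpow_le h.two_le hs hst ht.2 hx.2
    rw [(h.matrixFlow x).energy_inv le_rfl (hst.trans ht.2),
      Matrix.nonsing_inv_nonsing_inv _ ((h.matrixFlow x).isUnit_det ht)] at h1
    exact h1

/-- The integral of $|\ell_1-\ell_0|^p$ does not depend on $s$, yet it is bounded by a multiple of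
two integrals that vanish as $s\searrow0$. -/
theorem ae_eq_initial (h : IsSmallFlow p T ε ℓ) {t : ℝ} (ht : t ∈ Ioc 0 T)
    {ℓ₁ : TwoTensor n Ω} (hm : IsMeasurableTensor ℓ₁)
    (hlim : Tendsto (fun s => ∫⁻ x, ENNReal.ofReal
      (covNorm (ℓ t) (coeff (ℓ s) - coeff ℓ₁) x ^ p) ∂(vol (ℓ t))) (𝓝[>] 0) (𝓝 0)) :
    ∀ᵐ x ∂(vol (ℓ t)), ℓ₁ x = initialTensor T ℓ x := by
  have hT : 0 < T := ht.1.trans_le ht.2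
  have hp : 0 < p := by linarith [h.two_le]
  have hm0 := isMeasurableTensor_initialTensor h.flow hT
  have hmt := h.flow.isMeasurableTensor ht
  have hmeas {A B : TwoTensor n Ω} (hA : IsMeasurableTensor A) (hB : IsMeasurableTensor B) :
      AEMeasurable (fun x => ENNReal.ofReal (covNorm (ℓ t) (coeff A - coeff B) x ^ p))
        (vol (ℓ t)) :=
    ENNReal.measurable_ofReal.comp_aemeasurable
      ((aemeasurable_covNorm_sub hmt hA hB _).pow_const p)
  have hlim0 := tendsto_lintegral_of_le ht.1 fun s hs hst =>
    (h.lintegral_sub_initial_le hs hst ht).1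
  have hsum := ENNReal.Tendsto.const_mul (a := ENNReal.ofReal (2 ^ (p - 1))) (hlim.add hlim0)
    (Or.inr ENNReal.ofReal_ne_top)
  rw [add_zero, mul_zero] at hsum
  have hle : ∀ᶠ s in 𝓝[>] (0 : ℝ), ∫⁻ x, ENNReal.ofReal
      (covNorm (ℓ t) (coeff ℓ₁ - coeff (initialTensor T ℓ)) x ^ p) ∂(vol (ℓ t)) ≤
      ENNReal.ofReal (2 ^ (p - 1)) * (∫⁻ x, ENNReal.ofReal
        (covNorm (ℓ t) (coeff (ℓ s) - coeff ℓ₁) x ^ p) ∂(vol (ℓ t)) + ∫⁻ x, ENNReal.ofReal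
        (covNorm (ℓ t) (coeff (ℓ s) - coeff (initialTensor T ℓ)) x ^ p) ∂(vol (ℓ t))) := by
    filter_upwards [Ioo_mem_nhdsGT hT] with s hs
    have hms := h.flow.isMeasurableTensor (Ioo_subset_Ioc_self hs)
    rw [← lintegral_add_left' (hmeas hms hm), ← lintegral_const_mul' _ _ ENNReal.ofReal_ne_top]
    refine lintegral_mono fun x => ?_
    have h1 := ofReal_tnorm_add_rpow_le (h.flow.posDef_coeff ht x).inv h.two_le
      (coeff ℓ₁ x - coeff (ℓ s) x) (coeff (ℓ s) x - coeff (initialTensor T ℓ) x)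
    rw [sub_add_sub_cancel, tnorm_sub_comm _ (coeff ℓ₁ x) (coeff (ℓ s) x)] at h1
    exact h1
  have h0 := le_antisymm (ge_of_tendsto hsum hle) zero_le
  rw [lintegral_eq_zero_iff' (hmeas hm hm0)] at h0
  filter_upwards [h0] with x hx
  have h1 : covNorm (ℓ t) (coeff ℓ₁ - coeff (initialTensor T ℓ)) x ^ p ≤ 0 := by
    simpa using hx
  have h2 : covNorm (ℓ t) (coeff ℓ₁ - coeff (initialTensor T ℓ)) x = 0 :=
    ((Real.rpow_eq_zero (tnorm_nonneg _ _) hp.ne').1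
      (le_antisymm h1 (Real.rpow_nonneg (tnorm_nonneg _ _) _)))
  exact ext_coeff (sub_eq_zero.1 (tnorm_eq_zero (h.flow.posDef_coeff ht x).inv h2))

end IsSmallFlow

end InitialTensor

/-! ### Elementary inequalities and the main theorem. -/

theorem mul_rpow_sub_le_sub {s t : ℝ} (hs : 0 < s) (hst : s ≤ t) :
    t ^ (3 / 4 : ℝ) * (t ^ (1 / 4 : ℝ) - s ^ (1 / 4 : ℝ)) ≤ t - s := by
  have ht : 0 < t := hs.trans_le hst
  have e1 : t ^ (3 / 4 : ℝ) * t ^ (1 / 4 : ℝ) = t := by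
    rw [← Real.rpow_add ht]; norm_num
  have e2 : s ^ (3 / 4 : ℝ) * s ^ (1 / 4 : ℝ) = s := by
    rw [← Real.rpow_add hs]; norm_num
  have e3 : s ^ (3 / 4 : ℝ) * s ^ (1 / 4 : ℝ) ≤ t ^ (3 / 4 : ℝ) * s ^ (1 / 4 : ℝ) := by gcongr
  linarith

/-- Subadditivity of the fourth root. -/
theorem rpow_sub_rpow_le {r s : ℝ} (hr : 0 < r) (hrs : r ≤ s) :
    s ^ (1 / 4 : ℝ) - r ^ (1 / 4 : ℝ) ≤ (s - r) ^ (1 / 4 : ℝ) := by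
  have := Real.rpow_add_le_add_rpow hr.le (sub_nonneg.2 hrs) (by norm_num : (0 : ℝ) ≤ 1 / 4)
    (by norm_num)
  rw [add_sub_cancel] at this
  linarith

theorem estConst_nonneg (n : ℕ) {p : ℝ} (hp : 0 ≤ p) : 0 ≤ estConst n p := by
  unfold estConst; positivity

end RFlow

end

open RFlow in
theorem theorem2p4 (n : ℕ) (p : ℝ) (hp : 2 ≤ p) :
    ∃ (α₀ : ℝ) (δ : ℝ → ℝ) (C : ℝ),
      0 < α₀ ∧ (∀ ε, 0 < δ ε) ∧ Tendsto δ (𝓝[>] 0) (𝓝 0) ∧ 0 < C ∧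
      ∀ (Ω : Type*) [TopologicalSpace Ω] [ChartedSpace (EuclideanSpace ℝ (Fin n)) Ω]
        [IsManifold (𝓡 n) ∞ Ω] [T2Space Ω] [SecondCountableTopology Ω]
        [MeasurableSpace Ω] [BorelSpace Ω]
        (T ε : ℝ) (ℓ : ℝ → RFlow.TwoTensor n Ω),
        0 < T → 0 ≤ ε → ε ≤ α₀ → RFlow.IsRicciFlow T ℓ →
        (∀ t ∈ Ioc 0 T,
          ∫⁻ x, ENNReal.ofReal (RFlow.covNorm (ℓ t) (RFlow.ricci (ℓ t)) x) ∂(RFlow.vol (ℓ t))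
            ≤ ENNReal.ofReal ε) →
        (∀ t ∈ Ioc 0 T, ∀ x, RFlow.covNorm (ℓ t) (RFlow.ricci (ℓ t)) x ≤ ε / t) →
        -- distance between two times
        (∀ t ∈ Ioc 0 T, ∀ s ∈ Ioc 0 T, s < t →
          ∫⁻ x, ENNReal.ofReal
              (RFlow.covNorm (ℓ t) (RFlow.coeff (ℓ t) - RFlow.coeff (ℓ s)) x ^ p)
              ∂(RFlow.vol (ℓ t))
            ≤ ENNReal.ofReal (δ ε * |t - s|) ∧
          ∫⁻ x, ENNReal.ofReal
              (RFlow.contraNorm (ℓ t) (RFlow.coeffInv (ℓ t) - RFlow.coeffInv (ℓ s)) x ^ p)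
              ∂(RFlow.vol (ℓ t))
            ≤ ENNReal.ofReal (δ ε * |t - s|)) ∧
        -- bounds for a single time
        (∀ t ∈ Ioc 0 T, ∀ s ∈ Ioc 0 T, s < t →
          ∫⁻ x, ENNReal.ofReal (RFlow.covNorm (ℓ t) (RFlow.coeff (ℓ s)) x ^ p)
              ∂(RFlow.vol (ℓ t))
            ≤ ENNReal.ofReal C * (RFlow.vol (ℓ t) univ + ENNReal.ofReal |t - s|) ∧
          ∫⁻ x, ENNReal.ofReal (RFlow.contraNorm (ℓ t) (RFlow.coeffInv (ℓ s)) x ^ p)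
              ∂(RFlow.vol (ℓ t))
            ≤ ENNReal.ofReal C * (RFlow.vol (ℓ t) univ + ENNReal.ofReal |t - s|)) ∧
        -- Cauchy estimates
        (∀ t ∈ Ioc 0 T, ∀ r ∈ Ioc 0 T, ∀ s ∈ Ioc 0 T, r < t → s < t →
          ∫⁻ x, ENNReal.ofReal
              (RFlow.covNorm (ℓ t) (RFlow.coeff (ℓ r) - RFlow.coeff (ℓ s)) x ^ p)
              ∂(RFlow.vol (ℓ t))
            ≤ ENNReal.ofReal C * (RFlow.vol (ℓ t) univ + ENNReal.ofReal t) ^ (3 / 4 : ℝ)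
                * ENNReal.ofReal (|r - s| ^ (1 / 4 : ℝ)) ∧
          ∫⁻ x, ENNReal.ofReal
              (RFlow.contraNorm (ℓ t) (RFlow.coeffInv (ℓ r) - RFlow.coeffInv (ℓ s)) x ^ p)
              ∂(RFlow.vol (ℓ t))
            ≤ ENNReal.ofReal C * (RFlow.vol (ℓ t) univ + ENNReal.ofReal t) ^ (3 / 4 : ℝ)
                * ENNReal.ofReal (|r - s| ^ (1 / 4 : ℝ))) ∧
        -- existence and uniqueness of the limit at time zero
        ∃ ℓ₀ : RFlow.TwoTensor n Ω,
          RFlow.IsMeasurableTensor ℓ₀ ∧ RFlow.IsSymmetric ℓ₀ ∧ RFlow.IsPosDef ℓ₀ ∧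
          (∀ t ∈ Ioc 0 T,
            (∀ A : Set Ω, MeasurableSet A → RFlow.vol (ℓ t) A < ⊤ →
              ∫⁻ x in A, ENNReal.ofReal (RFlow.covNorm (ℓ t) (RFlow.coeff ℓ₀) x ^ p)
                ∂(RFlow.vol (ℓ t)) < ⊤ ∧
              ∫⁻ x in A, ENNReal.ofReal (RFlow.contraNorm (ℓ t) (RFlow.coeffInv ℓ₀) x ^ p)
                ∂(RFlow.vol (ℓ t)) < ⊤) ∧
            Tendsto (fun s => ∫⁻ x, ENNReal.ofReal
                (RFlow.covNorm (ℓ t) (RFlow.coeff (ℓ s) - RFlow.coeff ℓ₀) x ^ p)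
                ∂(RFlow.vol (ℓ t))) (𝓝[>] 0) (𝓝 0) ∧
            Tendsto (fun s => ∫⁻ x, ENNReal.ofReal
                (RFlow.contraNorm (ℓ t) (RFlow.coeffInv (ℓ s) - RFlow.coeffInv ℓ₀) x ^ p)
                ∂(RFlow.vol (ℓ t))) (𝓝[>] 0) (𝓝 0)) ∧
          (∀ ℓ₁ : RFlow.TwoTensor n Ω, RFlow.IsMeasurableTensor ℓ₁ →
            ∀ t ∈ Ioc 0 T,
              Tendsto (fun s => ∫⁻ x, ENNReal.ofReal
                  (RFlow.covNorm (ℓ t) (RFlow.coeff (ℓ s) - RFlow.coeff ℓ₁) x ^ p)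
                  ∂(RFlow.vol (ℓ t))) (𝓝[>] 0) (𝓝 0) →
              ∀ᵐ x ∂(RFlow.vol (ℓ t)), ℓ₁ x = ℓ₀ x) := by
  have hp0 : 0 < p := by linarith
  set κ := estConst n p with hκ
  have hκ0 : 0 ≤ κ := estConst_nonneg n hp0.le
  -- The largest threshold for which $(2p+n)\varepsilon\le3/4$.
  set α : ℝ := 3 / (4 * (2 * p + n)) with hα
  have hα0 : 0 < α := by positivity
  set C : ℝ := 2 ^ (p - 1) * (Real.sqrt n ^ p + κ * α) + κ * α + 1 with hC
  have hD0 : (0 : ℝ) < 2 ^ (p - 1) := by positivity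
  have hC1 : 2 ^ (p - 1) * (Real.sqrt n ^ p) ≤ C := by
    have : 0 ≤ 2 ^ (p - 1) * (κ * α) := by positivity
    have : 0 ≤ κ * α := by positivity
    rw [hC, mul_add]; linarith
  have hC2 : 2 ^ (p - 1) * (κ * α) ≤ C := by
    have : 0 ≤ 2 ^ (p - 1) * Real.sqrt n ^ p := by positivity
    have : 0 ≤ κ * α := by positivity
    rw [hC, mul_add]; linarith
  have hC3 : κ * α ≤ C := by
    have : 0 ≤ 2 ^ (p - 1) * (Real.sqrt n ^ p + κ * α) := by positivity
    rw [hC]; linarith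
  have hC0 : 0 < C := by positivity
  -- The summand $1$ keeps $\delta$ positive when $\kappa=0$, as for $n=0$. The value at
  -- $\varepsilon=0$ is free, since the estimate obtained there has right-hand side zero.
  refine ⟨α, fun ε => if 0 < ε then (κ + 1) * ε else 1, C, hα0, fun ε => ?_, ?_, hC0, ?_⟩
  · dsimp only
    split_ifs <;> positivity
  · have h1 : Tendsto (fun ε : ℝ => (κ + 1) * ε) (𝓝[>] 0) (𝓝 0) := by
      have := ((continuous_const_mul (κ + 1)).tendsto (0 : ℝ)).mono_left
        (nhdsWithin_le_nhds (s := Ioi (0 : ℝ)))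
      simpa using this
    refine h1.congr' ?_
    filter_upwards [self_mem_nhdsWithin] with ε hε
    rw [if_pos (mem_Ioi.1 hε)]
  intro Ω _ _ _ _ _ _ _ T ε ℓ hT hε hεα hflow hint hbound
  have hsmall : (2 * p + n) * ε ≤ 3 / 4 := by
    have h1 : (2 * p + n) * ε ≤ (2 * p + n) * α := by gcongr
    have h2 : (2 * p + n) * α = 3 / 4 := by rw [hα]; field_simp
    linarith
  have h : IsSmallFlow p T ε ℓ := ⟨hp, hflow, hε, hsmall, hint, hbound⟩
  have hκε : κ * ε ≤ κ * α := by gcongr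
  have hdist : ∀ t ∈ Ioc 0 T, ∀ s ∈ Ioc 0 T, s < t →
      ∫⁻ x, ENNReal.ofReal (covNorm (ℓ t) (coeff (ℓ t) - coeff (ℓ s)) x ^ p) ∂(vol (ℓ t))
        ≤ ENNReal.ofReal (κ * ε * |t - s|) ∧
      ∫⁻ x, ENNReal.ofReal (contraNorm (ℓ t) (coeffInv (ℓ t) - coeffInv (ℓ s)) x ^ p)
        ∂(vol (ℓ t)) ≤ ENNReal.ofReal (κ * ε * |t - s|) := by
    intro t ht s hs hst
    have h1 := h.lintegral_sub_le hs.1 hst.le le_rfl ht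
    have h2 : ENNReal.ofReal (κ * ε * (t ^ (3 / 4 : ℝ) * (t ^ (1 / 4 : ℝ) - s ^ (1 / 4 : ℝ))))
        ≤ ENNReal.ofReal (κ * ε * |t - s|) := by
      refine ENNReal.ofReal_le_ofReal ?_
      rw [abs_of_pos (sub_pos.2 hst)]
      exact mul_le_mul_of_nonneg_left (mul_rpow_sub_le_sub hs.1 hst.le) (by positivity)
    constructor
    · refine le_trans (lintegral_mono fun x => ?_) (h1.1.trans h2)
      exact (congrArg (fun a => ENNReal.ofReal (a ^ p)) (tnorm_sub_comm _ _ _)).le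
    · refine le_trans (lintegral_mono fun x => ?_) (h1.2.trans h2)
      exact (congrArg (fun a => ENNReal.ofReal (a ^ p)) (tnorm_sub_comm _ _ _)).le
  have hcauchy : ∀ t ∈ Ioc 0 T, ∀ r ∈ Ioc 0 T, ∀ s ∈ Ioc 0 T, r ≤ s → s < t →
      ENNReal.ofReal (κ * ε * (t ^ (3 / 4 : ℝ) * (s ^ (1 / 4 : ℝ) - r ^ (1 / 4 : ℝ))))
      ≤ ENNReal.ofReal C * (vol (ℓ t) univ + ENNReal.ofReal t) ^ (3 / 4 : ℝ)
        * ENNReal.ofReal (|r - s| ^ (1 / 4 : ℝ)) := by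
    intro t ht r hr s hs hrs hst
    calc ENNReal.ofReal (κ * ε * (t ^ (3 / 4 : ℝ) * (s ^ (1 / 4 : ℝ) - r ^ (1 / 4 : ℝ))))
        ≤ ENNReal.ofReal (C * t ^ (3 / 4 : ℝ) * |r - s| ^ (1 / 4 : ℝ)) := by
          refine ENNReal.ofReal_le_ofReal ?_
          rw [abs_sub_comm, abs_of_nonneg (sub_nonneg.2 hrs), mul_assoc C]
          have h1 := rpow_sub_rpow_le hr.1 hrs
          have h2 : 0 ≤ t ^ (3 / 4 : ℝ) := Real.rpow_nonneg ht.1.le _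
          have h3 : 0 ≤ (s - r) ^ (1 / 4 : ℝ) := Real.rpow_nonneg (sub_nonneg.2 hrs) _
          calc κ * ε * (t ^ (3 / 4 : ℝ) * (s ^ (1 / 4 : ℝ) - r ^ (1 / 4 : ℝ)))
              ≤ κ * ε * (t ^ (3 / 4 : ℝ) * (s - r) ^ (1 / 4 : ℝ)) := by gcongr
            _ ≤ C * (t ^ (3 / 4 : ℝ) * (s - r) ^ (1 / 4 : ℝ)) :=
                mul_le_mul_of_nonneg_right (hκε.trans hC3) (by positivity)
      _ = ENNReal.ofReal C * ENNReal.ofReal t ^ (3 / 4 : ℝ)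
          * ENNReal.ofReal (|r - s| ^ (1 / 4 : ℝ)) := by
          rw [ENNReal.ofReal_mul (mul_nonneg hC0.le (Real.rpow_nonneg ht.1.le _)),
            ENNReal.ofReal_mul hC0.le, ENNReal.ofReal_rpow_of_pos ht.1]
      -- The volume only enlarges the right-hand side; the estimate already holds with $t^{3/4}$.
      _ ≤ _ := by
          gcongr
          exact le_add_self
  have hsingle : ∀ t ∈ Ioc 0 T, ∀ (s : ℝ) (I : ℝ≥0∞), I ≤ ENNReal.ofReal (κ * ε * |t - s|) →
      ENNReal.ofReal (2 ^ (p - 1)) * (ENNReal.ofReal (Real.sqrt n ^ p) * vol (ℓ t) univ + I)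
        ≤ ENNReal.ofReal C * (vol (ℓ t) univ + ENNReal.ofReal |t - s|) := by
    intro t _ s I hI
    rw [mul_add, mul_add, ← mul_assoc, ← ENNReal.ofReal_mul hD0.le]
    refine add_le_add (mul_le_mul_left (ENNReal.ofReal_le_ofReal hC1) _)
      ((mul_le_mul_right hI _).trans ?_)
    rw [← ENNReal.ofReal_mul hD0.le, ← ENNReal.ofReal_mul hC0.le, ← mul_assoc]
    refine ENNReal.ofReal_le_ofReal (mul_le_mul_of_nonneg_right ?_ (abs_nonneg _))
    exact (mul_le_mul_of_nonneg_left hκε hD0.le).trans hC2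
  refine ⟨fun t ht s hs hst => ?_, fun t ht s hs hst => ?_, fun t ht r hr s hs hrt hst => ?_,
    initialTensor T ℓ, isMeasurableTensor_initialTensor hflow hT,
    isSymmetric_ofCoeff (posDef_initialCoeff hflow hT),
    isPosDef_ofCoeff (posDef_initialCoeff hflow hT),
    fun t ht => ⟨fun A _ hAfin => ?_, ?_, ?_⟩,
    fun ℓ₁ hm t ht hlim => h.ae_eq_initial ht hm hlim⟩
  · have hδ : ENNReal.ofReal (κ * ε * |t - s|)
        ≤ ENNReal.ofReal ((if 0 < ε then (κ + 1) * ε else 1) * |t - s|) := by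
      refine ENNReal.ofReal_le_ofReal (mul_le_mul_of_nonneg_right ?_ (abs_nonneg _))
      split_ifs with hpos
      · linarith
      · rw [le_antisymm (not_lt.1 hpos) hε]; simp
    exact ⟨(hdist t ht s hs hst).1.trans hδ, (hdist t ht s hs hst).2.trans hδ⟩
  · have h1 := h.setLIntegral_covNorm_le ht univ (coeff (ℓ s))
    have h2 := h.setLIntegral_contraNorm_le ht univ (coeffInv (ℓ s))
    rw [Measure.restrict_univ] at h1 h2
    exact ⟨h1.trans (hsingle t ht s _ (hdist t ht s hs hst).1),
      h2.trans (hsingle t ht s _ (hdist t ht s hs hst).2)⟩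
  · rcases le_total r s with hrs | hrs
    · have h1 := h.lintegral_sub_le hr.1 hrs hst.le ht
      have h2 := hcauchy t ht r hr s hs hrs hst
      exact ⟨h1.1.trans h2, h1.2.trans h2⟩
    · have h1 := h.lintegral_sub_le hs.1 hrs hrt.le ht
      have h2 := hcauchy t ht s hs r hr hrs hrt
      rw [abs_sub_comm] at h2
      constructor
      · refine le_trans (lintegral_mono fun x => ?_) (h1.1.trans h2)
        exact (congrArg (fun a => ENNReal.ofReal (a ^ p)) (tnorm_sub_comm _ _ _)).le
      · refine le_trans (lintegral_mono fun x => ?_) (h1.2.trans h2)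
        exact (congrArg (fun a => ENNReal.ofReal (a ^ p)) (tnorm_sub_comm _ _ _)).le
  -- The choice $s=t$ bounds the distance from $\ell_0$ to the reference metric itself, which has
  -- constant norm $\sqrt n$.
  · have h0 := h.lintegral_sub_initial_le ht.1 le_rfl ht
    have hfin {I : ℝ≥0∞} {K : ℝ} (hI : I ≤ ENNReal.ofReal K) :
        ENNReal.ofReal (2 ^ (p - 1)) * (ENNReal.ofReal (Real.sqrt n ^ p) * vol (ℓ t) A + I) < ⊤ :=
      ENNReal.mul_lt_top ENNReal.ofReal_lt_top (ENNReal.add_lt_top.2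
        ⟨ENNReal.mul_lt_top ENNReal.ofReal_lt_top hAfin, hI.trans_lt ENNReal.ofReal_lt_top⟩)
    exact ⟨(h.setLIntegral_covNorm_le ht A _).trans_lt (hfin h0.1),
      (h.setLIntegral_contraNorm_le ht A _).trans_lt (hfin h0.2)⟩
  · exact tendsto_lintegral_of_le ht.1 fun s hs hst => (h.lintegral_sub_initial_le hs hst ht).1
  · exact tendsto_lintegral_of_le ht.1 fun s hs hst => (h.lintegral_sub_initial_le hs hst ht).2
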